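/- Theorem (Linearized stability theorem). Let $d\in\mathbb N$, let $\|\cdot\|$ be any norm on $\mathbb R^d$, let $\alpha\in(0,1)$, $\tau>0$, $A\in\mathbb R^{d\times d}$ and $g:\mathbb R^d\times\mathbb R^d\to\mathbb R^d$. Consider the delay Caputo fractional initial value problem $$ {}^{C}\!D^{\alpha}_{0+}x(t)=A\,x(t-\tau)+g\bigl(x(t),x(t-\tau)\bigr)\quad (t>0),\qquad x(t)=\phi(t)\quad (t\in[-\tau,0]), \tag{1}$$ with $\phi\in C([-\tau,0];\mathbb R^d)$. Here the Caputo derivative is taken componentwise and, for a continuous real function $x$, it is ${}^{C}\!D^{\alpha}_{0+}x(t)=\frac{d}{dt}\,\frac{1}{\Gamma(1-\alpha)}\int_0^t (t-s)^{-\alpha}\bigl(x(s)-x(0)\bigr)\,ds$. For $T>0$, a solution of (1) over $[-\tau,T]$ is a continuous function $x:[-\tau,T]\to\mathbb R^d$ with $x=\phi$ on $[-\tau,0]$ whose Caputo derivative exists and satisfies the equation at every $t\in(0,T]$ (the derivative $\frac{d}{dt}$ at $t=T$ being the left one). Assume that 1. $g(0,0)=0$; 2. $g$ is locally Lipschitz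 continuous in a neighbourhood of the origin and $\lim_{\varrho\to0^+}\ell_g(\varrho)=0$, where $$\ell_g(\varrho)=\sup\left\{\frac{\|g(x,y)-g(\hat x,\hat y)\|}{\|x-\hat x\|+\|y-\hat y\|}\;:\;\|x\|,\|y\|,\|\hat x\|,\|\hat y\|\le\varrho,\ (x,y)\ne(\hat x,\hat y)\right\};$$ 3. every eigenvalue of $A$ in $\mathbb C$ lies in $$\mathcal S_{\alpha,\tau}=\left\{\lambda\in\mathbb C\setminus\{0\}:\ |\lambda|<\left(\frac{|\arg\lambda|-\alpha\pi/2}{\tau}\right)^{\alpha},\ \frac{\alpha\pi}{2}<|\arg\lambda|\le\pi\right\}.$$ Then the trivial solution of (1) is asymptotically stable, that is: (i) for every $\varepsilon>0$ there is $\delta>0$ such that for every $\phi\in C([-\tau,0];\mathbb R^d)$ with $\sup_{[-\tau,0]}\|\phi\|\le\delta$ the problem (1) has a solution $\varphi(\cdot,\phi)$ on $[-\tau,\infty)$, it is unique (every solution over some $[-\tau,T]$ is a restriction of it), and $\|\varphi(t,\phi)\|\le\varepsilon$ for all $t\ge0$; (ii) there is $\hat\delta>0$ such that for every $\phi\in C([-\tau,0];\mathbb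 R^d)$ with $\sup_{[-\tau,0]}\|\phi\|\le\hat\delta$ the problem (1) has a unique solution $\varphi(\cdot,\phi)$ on $[-\tau,\infty)$ in the same sense, and $\lim_{t\to\infty}\varphi(t,\phi)=0$. -/

import Mathlib

open Set Filter Topology
open scoped ENNReal

namespace DelayFDE

/-- The Riemann--Liouville integral of order `β` based at `0` of a real function:
`(1 / Γ(β)) ∫₀ᵗ (t - s)^(β - 1) x(s) ds`. -/
noncomputable def rlIntegral (β : ℝ) (x : ℝ → ℝ) (t : ℝ) : ℝ :=
  (1 / Real.Gamma β) * ∫ s in (0 : ℝ)..t, (t - s) ^ (β - 1) * x s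

/-- For `0 < α < 1`, `t ∈ (0, T]` and `x` continuous on `[0, T]`: the function `x` has Caputo
derivative `y` of order `α`, based at `0`, at the point `t` of the interval `[0, T]`. The Caputo
derivative of a continuous function is `d/dt I^{1-α} (x - x(0))`, the derivative at the end point
`T` being the left one. On absolutely continuous `x` this is `I^{1-α} x'`. -/
def HasCaputoDerivWithin (α T : ℝ) (x : ℝ → ℝ) (y t : ℝ) : Prop :=
  HasDerivWithinAt (rlIntegral (1 - α) (fun s => x s - x 0)) y (Icc 0 T) t

/-- `x` is a solution over `[-τ, T]` of the initial value problem
`ᶜD^α x(t) = A x(t - τ) + g(x(t), x(t - τ))` on `(0, T]`, `x = φ` on `[-τ, 0]`,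
the Caputo derivative being taken componentwise. -/
structure IsSolutionOn {d : ℕ} (α τ : ℝ) (A : Matrix (Fin d) (Fin d) ℝ)
    (g : (Fin d → ℝ) → (Fin d → ℝ) → (Fin d → ℝ)) (φ : ℝ → Fin d → ℝ) (T : ℝ)
    (x : ℝ → Fin d → ℝ) : Prop where
  continuousOn : ContinuousOn x (Icc (-τ) T)
  equation : ∀ t ∈ Ioc 0 T, ∀ i : Fin d,
    HasCaputoDerivWithin α T (fun s => x s i)
      ((A.mulVec (x (t - τ)) + g (x t) (x (t - τ))) i) t
  initial : ∀ t ∈ Icc (-τ) 0, x t = φ t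

/-- `x` is the solution with initial function `φ` and its maximal interval of existence is
`[-τ, ∞)`: it is a solution over every `[-τ, T]`, and every solution over some `[-τ, T]` is a
restriction of it. -/
def IsTheGlobalSolution {d : ℕ} (α τ : ℝ) (A : Matrix (Fin d) (Fin d) ℝ)
    (g : (Fin d → ℝ) → (Fin d → ℝ) → (Fin d → ℝ)) (φ : ℝ → Fin d → ℝ)
    (x : ℝ → Fin d → ℝ) : Prop :=
  (∀ T : ℝ, 0 < T → IsSolutionOn α τ A g φ T x) ∧
    ∀ T : ℝ, 0 < T → ∀ y : ℝ → Fin d → ℝ, IsSolutionOn α τ A g φ T y →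
      EqOn y x (Icc (-τ) T)

/-- Stability of the trivial solution, with respect to the norm `p` on `ℝ^d`. -/
def IsStable {d : ℕ} (p : Seminorm ℝ (Fin d → ℝ)) (α τ : ℝ) (A : Matrix (Fin d) (Fin d) ℝ)
    (g : (Fin d → ℝ) → (Fin d → ℝ) → (Fin d → ℝ)) : Prop :=
  ∀ ε : ℝ, 0 < ε → ∃ δ : ℝ, 0 < δ ∧
    ∀ φ : ℝ → Fin d → ℝ, ContinuousOn φ (Icc (-τ) 0) → (∀ s ∈ Icc (-τ) 0, p (φ s) ≤ δ) →
      ∃ x : ℝ → Fin d → ℝ, IsTheGlobalSolution α τ A g φ x ∧ ∀ t : ℝ, 0 ≤ t → p (x t) ≤ ε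

/-- Asymptotic stability of the trivial solution, with respect to the norm `p` on `ℝ^d`. -/
def IsAsymptoticallyStable {d : ℕ} (p : Seminorm ℝ (Fin d → ℝ)) (α τ : ℝ)
    (A : Matrix (Fin d) (Fin d) ℝ)
    (g : (Fin d → ℝ) → (Fin d → ℝ) → (Fin d → ℝ)) : Prop :=
  IsStable p α τ A g ∧ ∃ δ : ℝ, 0 < δ ∧
    ∀ φ : ℝ → Fin d → ℝ, ContinuousOn φ (Icc (-τ) 0) → (∀ s ∈ Icc (-τ) 0, p (φ s) ≤ δ) →
      ∃ x : ℝ → Fin d → ℝ, IsTheGlobalSolution α τ A g φ x ∧ Tendsto x atTop (𝓝 0)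

/-- The domain `S_{α,τ}` of the complex plane. -/
def stabilityRegion (α τ : ℝ) : Set ℂ :=
  {z : ℂ | z ≠ 0 ∧ ‖z‖ < ((|z.arg| - α * Real.pi / 2) / τ) ^ α ∧
    α * Real.pi / 2 < |z.arg| ∧ |z.arg| ≤ Real.pi}

/-- The Lipschitz modulus `ℓ_g(ρ)` of `g` on the ball of radius `ρ` for the norm `p`, as an
extended nonnegative number. -/
noncomputable def lipModulus {d : ℕ} (p : Seminorm ℝ (Fin d → ℝ))
    (g : (Fin d → ℝ) → (Fin d → ℝ) → (Fin d → ℝ)) (ρ : ℝ) : ℝ≥0∞ :=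
  ⨆ (x : Fin d → ℝ) (y : Fin d → ℝ) (x' : Fin d → ℝ) (y' : Fin d → ℝ)
    (_ : (p x ≤ ρ ∧ p y ≤ ρ ∧ p x' ≤ ρ ∧ p y' ≤ ρ) ∧ (x, y) ≠ (x', y')),
    ENNReal.ofReal (p (g x y - g x' y') / (p (x - x') + p (y - y')))

end DelayFDE

/-! Write a solution as x = ψ + z. Here ψ continues the history by a piecewise linear cutoff of φ(0)
that vanishes for t ≥ 1, and z vanishes for t ≤ 0. In integrated form, z satisfies I^{1-α} z = I(A
z(· - τ) + h), where h collects g and the contribution of ψ. The cutoff, unlike a constant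
continuation, lets h tend to 0 at infinity.

In Laplace variables this reads s^α z = A e^{-sτ} z + h. The symbol s^α is unbounded, so the
equation is multiplied by (1 + s)^{-α}. It becomes (1 - Q(N + A S)) z = Q h, where Q and N have
integrable kernels with transforms (1 + s)^{-α} and (1 + s)^α - s^α, and S is the shift by τ. All
these operators act boundedly on the Banach space of continuous functions that vanish on (-∞, 0] and
at infinity, so an inverse bounded on that space yields decay without estimates of a fundamental
solution.

The inverse comes from Gelfand theory. Convolutions and shifts generate a commutative Banach
algebra, and a matrix over it is invertible as soon as no character annihilates its determinant. By
`character_cases` a character either kills every tempered kernel, so that the determinant goes to 1,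
or is the Laplace transform at some s with Re s ≥ 0. In the second case the determinant is a nonzero
multiple of det(s^α e^{sτ} - A). This is nonzero because s^α e^{sτ} avoids the stability region
(`cpow_mul_exp_notMem_stabilityRegion`), which contains every eigenvalue of A. The outcome is the
bounded solver of `exists_linear_solver`.

Near the origin g has an arbitrarily small Lipschitz constant. After truncation to a cube, z ↦ G(Q
h(z)), with G the solver, is a contraction; its fixed point is bounded by a multiple of sup ‖φ‖ and
decays, and for small φ it never leaves the cube (`exists_decaying_solution`). Uniqueness against
arbitrary competitors is a local argument: the equation is inverted to U = I^α F for the difference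
U, and the mass of the kernel on a short interval is small. -/

namespace DelayFDE

open MeasureTheory

/-! ### Convolution of causal functions. -/

section Convolution

variable {E : Type*} [NormedAddCommGroup E]

/-- Functions vanishing on the negative half-line, integrable on every `(-∞, T]`. -/
structure CausalInt (a : ℝ → E) : Prop where
  zero : ∀ t < 0, a t = 0
  int : ∀ T, IntegrableOn a (Iic T)

/-- Functions vanishing on the negative half-line and continuous on `[0, ∞)`. -/
structure CausalCont (w : ℝ → E) : Prop where
  zero : ∀ t < 0, w t = 0
  cont : ContinuousOn w (Ici 0)

theorem CausalInt.indicator {a : ℝ → E} (ha : CausalInt a) (T : ℝ) :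
    Integrable (indicator (Iic T) a) :=
  (integrable_indicator_iff measurableSet_Iic).2 (ha.int T)

theorem CausalInt.of_integrable {a : ℝ → E} (h : Integrable a) (h0 : ∀ t < 0, a t = 0) :
    CausalInt a := ⟨h0, fun _ => h.integrableOn⟩

theorem CausalInt.of_intervalIntegrable {a : ℝ → E} (h0 : ∀ t < 0, a t = 0)
    (h : ∀ T, 0 < T → IntegrableOn a (Ioc 0 T)) : CausalInt a := by
  refine ⟨h0, fun T => ?_⟩
  have h1 : IntegrableOn a (Iio 0) :=
    IntegrableOn.congr_fun (f := fun _ => (0 : E)) integrableOn_zero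
      (fun t ht => (h0 t ht).symm) measurableSet_Iio
  have h2 : IntegrableOn a (Iic 0) := (integrableOn_Iic_iff_integrableOn_Iio).2 h1
  have h3 := h2.union (h (max T 1) (by positivity))
  rw [Iic_union_Ioc_eq_Iic (by positivity)] at h3
  exact h3.mono_set (Iic_subset_Iic.2 (le_max_left _ _))

theorem CausalCont.bound {w : ℝ → E} (hw : CausalCont w) (T : ℝ) :
    ∃ C, 0 ≤ C ∧ ∀ t ≤ T, ‖w t‖ ≤ C := by
  obtain ⟨C, hC⟩ := (isCompact_Icc (a := (0 : ℝ)) (b := T)).exists_bound_of_continuousOn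
    (hw.cont.mono Icc_subset_Ici_self)
  refine ⟨max C 0, le_max_right _ _, fun t ht => ?_⟩
  rcases lt_or_ge t 0 with h | h
  · simp [hw.zero t h]
  · exact (hC t ⟨h, ht⟩).trans (le_max_left _ _)

theorem CausalCont.causalInt {w : ℝ → E} (hw : CausalCont w) : CausalInt w :=
  CausalInt.of_intervalIntegrable hw.zero fun _ _ =>
    ((hw.cont.mono Icc_subset_Ici_self).integrableOn_Icc).mono_set Ioc_subset_Icc_self

theorem CausalCont.of_continuous {w : ℝ → E} (h : Continuous w) (h0 : ∀ t < 0, w t = 0) :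
    CausalCont w := ⟨h0, h.continuousOn⟩

theorem CausalCont.continuousAt {w : ℝ → E} (hw : CausalCont w) {t : ℝ} (ht : t ≠ 0) :
    ContinuousAt w t := by
  rcases lt_or_gt_of_ne ht with h | h
  · exact continuousAt_const.congr (f := fun _ => (0 : E)) (by
      filter_upwards [Iio_mem_nhds h] with s hs using (hw.zero s hs).symm)
  · exact hw.cont.continuousAt (Ici_mem_nhds h)

theorem CausalCont.stronglyMeasurable {w : ℝ → E} (hw : CausalCont w) :
    AEStronglyMeasurable w volume := by
  have h := (hw.cont.aestronglyMeasurable (μ := volume) measurableSet_Ici)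
  rw [← aestronglyMeasurable_indicator_iff measurableSet_Ici] at h
  have hi : indicator (Ici 0) w = w := by
    funext t
    rcases lt_or_ge t 0 with ht | ht
    · simp [ht, hw.zero t ht]
    · simp [ht]
  rwa [hi] at h

theorem CausalCont.add {v w : ℝ → E} (hv : CausalCont v) (hw : CausalCont w) :
    CausalCont (fun t => v t + w t) :=
  ⟨fun t ht => by simp [hv.zero t ht, hw.zero t ht], hv.cont.add hw.cont⟩

theorem CausalCont.sub {v w : ℝ → E} (hv : CausalCont v) (hw : CausalCont w) :
    CausalCont (fun t => v t - w t) :=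
  ⟨fun t ht => by simp [hv.zero t ht, hw.zero t ht], hv.cont.sub hw.cont⟩

theorem causalCont_one : CausalCont (indicator (Ici (0 : ℝ)) (1 : ℝ → ℝ)) :=
  ⟨fun t ht => by simp [ht], continuousOn_const.congr fun t ht => by
    simpa using indicator_of_mem ht (1 : ℝ → ℝ)⟩

variable [NormedSpace ℝ E]

/-- Convolution over the real line of a real kernel with a vector-valued function. -/
noncomputable def conv (a : ℝ → ℝ) (w : ℝ → E) (t : ℝ) : E := ∫ u, a u • w (t - u)

theorem conv_eq_convolution (a : ℝ → ℝ) (w : ℝ → E) :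
    conv a w = convolution a w (ContinuousLinearMap.lsmul ℝ ℝ) volume := rfl

theorem conv_swap (a : ℝ → ℝ) (w : ℝ → E) (t : ℝ) :
    conv a w t = ∫ s, a (t - s) • w s := by
  rw [conv_eq_convolution, convolution_lsmul_swap]

theorem conv_comm (a b : ℝ → ℝ) : conv a b = conv b a := by
  funext t
  rw [conv_swap]
  simp [conv, mul_comm]

theorem conv_congr_ae {a a' : ℝ → ℝ} (h : a =ᵐ[volume] a') (w : ℝ → E) :
    conv a w = conv a' w := by
  funext t
  refine integral_congr_ae ?_
  filter_upwards [h] with u hu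
  simp only [hu]

theorem conv_zero_of_neg {a : ℝ → ℝ} {w : ℝ → E} (ha : ∀ t < 0, a t = 0) (hw : ∀ t < 0, w t = 0)
    {t : ℝ} (ht : t < 0) : conv a w t = 0 := by
  have : ∀ u, a u • w (t - u) = 0 := fun u => by
    rcases lt_or_ge u 0 with hu | hu
    · rw [ha u hu, zero_smul]
    · rw [hw _ (by linarith), smul_zero]
  simp [conv, this]

/-- Causality: with both factors supported in [0, ∞), only arguments in [0, t] matter. Locally
integrable kernels may therefore be truncated to integrable ones. -/
theorem conv_congr_of_le {a a' : ℝ → ℝ} {w w' : ℝ → E} {T t : ℝ} (ht : t ≤ T)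
    (ha : ∀ t < 0, a t = 0) (ha' : ∀ t < 0, a' t = 0)
    (hw : ∀ t < 0, w t = 0) (hw' : ∀ t < 0, w' t = 0)
    (haa : EqOn a a' (Iic T)) (hww : EqOn w w' (Iic T)) : conv a w t = conv a' w' t := by
  refine integral_congr_ae (Eventually.of_forall fun u => ?_)
  simp only
  rcases lt_or_ge u 0 with hu | hu
  · rw [ha u hu, ha' u hu, zero_smul, zero_smul]
  · rcases lt_or_ge (t - u) 0 with h | h
    · rw [hw _ h, hw' _ h, smul_zero, smul_zero]
    · rw [haa (show u ≤ T by linarith), hww (show t - u ≤ T by linarith)]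

theorem conv_eq_intervalIntegral {a : ℝ → ℝ} {w : ℝ → E} {t : ℝ} (ht : 0 ≤ t)
    (ha : ∀ t < 0, a t = 0) (hw : ∀ t < 0, w t = 0) :
    conv a w t = ∫ s in (0 : ℝ)..t, a (t - s) • w s := by
  rw [conv_swap, intervalIntegral.integral_of_le ht, ← integral_Icc_eq_integral_Ioc,
    setIntegral_eq_integral_of_forall_compl_eq_zero]
  intro s hs
  rcases lt_or_ge s 0 with h | h
  · rw [hw s h, smul_zero]
  · rw [ha (t - s) (by by_contra h'; exact hs ⟨h, by linarith⟩), zero_smul]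

theorem conv_indicator_one {w : ℝ → E} (hw : ∀ t < 0, w t = 0) {t : ℝ} (ht : 0 ≤ t) :
    conv (indicator (Ici 0) 1) w t = ∫ s in (0 : ℝ)..t, w s := by
  rw [conv_eq_intervalIntegral ht (fun t ht => by simp [ht]) hw]
  refine intervalIntegral.integral_congr fun s hs => ?_
  rw [uIcc_of_le ht] at hs
  simp [hs.2]

theorem CausalInt.conv {a b : ℝ → ℝ} (ha : CausalInt a) (hb : CausalInt b) :
    CausalInt (conv a b) := by
  refine ⟨fun t ht => conv_zero_of_neg ha.zero hb.zero ht, fun T => ?_⟩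
  have h := ((ha.indicator T).integrable_convolution (ContinuousLinearMap.lsmul ℝ ℝ)
    (hb.indicator T)).integrableOn (s := Iic T)
  refine h.congr_fun (fun t ht => ?_) measurableSet_Iic
  have hz : ∀ {c : ℝ → ℝ}, CausalInt c → ∀ t < 0, (Iic T).indicator c t = 0 := fun hc t ht => by
    simp [hc.zero t ht]
  exact conv_congr_of_le ht (hz ha) ha.zero (hz hb) hb.zero
    (fun s hs => indicator_of_mem hs a) (fun s hs => indicator_of_mem hs b)

theorem integrable_conv {a : ℝ → ℝ} {w : ℝ → E} (ha : CausalInt a) (hw : CausalCont w) (t : ℝ) :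
    Integrable fun u => a u • w (t - u) := by
  obtain ⟨C, -, hC⟩ := hw.bound t
  have h1 : Integrable fun u => (Iic t).indicator a u • w (t - u) := by
    refine Integrable.mono' (g := fun u => C * ‖(Iic t).indicator a u‖)
      ((ha.indicator t).norm.const_mul C) ?_ ?_
    · refine (ha.indicator t).aestronglyMeasurable.smul ?_
      exact hw.stronglyMeasurable.comp_quasiMeasurePreserving
        (quasiMeasurePreserving_sub_left volume t)
    · refine Eventually.of_forall fun u => ?_
      rw [norm_smul, mul_comm]
      rcases lt_or_ge u 0 with hu | hu
      · simp [indicator, ha.zero u hu]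
      · exact mul_le_mul_of_nonneg_right (hC _ (by linarith)) (norm_nonneg _)
  refine h1.congr (Eventually.of_forall fun u => ?_)
  simp only
  by_cases hu : u ≤ t
  · rw [indicator_of_mem (show u ∈ Iic t from hu)]
  · rw [hw.zero (t - u) (by linarith), smul_zero, smul_zero]

theorem conv_add_right {a : ℝ → ℝ} {v w : ℝ → E} (ha : CausalInt a) (hv : CausalCont v)
    (hw : CausalCont w) (t : ℝ) :
    conv a (fun t => v t + w t) t = conv a v t + conv a w t := by
  simp only [conv, smul_add]
  exact integral_add (integrable_conv ha hv t) (integrable_conv ha hw t)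

theorem conv_sub_right {a : ℝ → ℝ} {v w : ℝ → E} (ha : CausalInt a) (hv : CausalCont v)
    (hw : CausalCont w) (t : ℝ) :
    conv a (fun t => v t - w t) t = conv a v t - conv a w t := by
  simp only [conv, smul_sub]
  exact integral_sub (integrable_conv ha hv t) (integrable_conv ha hw t)

theorem conv_add_left {a b : ℝ → ℝ} {w : ℝ → E} (ha : CausalInt a) (hb : CausalInt b)
    (hw : CausalCont w) (t : ℝ) :
    conv (fun t => a t + b t) w t = conv a w t + conv b w t := by
  simp only [conv, add_smul]
  exact integral_add (integrable_conv ha hw t) (integrable_conv hb hw t)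

theorem conv_smul_right {R : Type*} [NormedField R] [NormedSpace R E] [SMulCommClass ℝ R E]
    (a : ℝ → ℝ) (c : R) (w : ℝ → E) (t : ℝ) :
    conv a (fun t => c • w t) t = c • conv a w t := by
  simp only [conv, smul_comm _ c]
  exact integral_smul c _

theorem norm_conv_le {a : ℝ → ℝ} {w : ℝ → E} (ha : Integrable a) {C : ℝ} (hC : ∀ t, ‖w t‖ ≤ C)
    (t : ℝ) : ‖conv a w t‖ ≤ (∫ u, ‖a u‖) * C := by
  rw [← integral_mul_const]
  refine norm_integral_le_of_norm_le (ha.norm.mul_const C) (Eventually.of_forall fun u => ?_)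
  rw [norm_smul]
  exact mul_le_mul_of_nonneg_left (hC _) (norm_nonneg _)

theorem continuous_conv {a : ℝ → ℝ} {w : ℝ → E} (ha : CausalInt a) (hw : CausalCont w) :
    Continuous (conv a w) := by
  refine continuous_iff_continuousAt.2 fun t₀ => ?_
  obtain ⟨C, hC0, hC⟩ := hw.bound (t₀ + 1)
  refine continuousAt_of_dominated (bound := fun u => ‖(Iic (t₀ + 1)).indicator a u‖ * C)
    (Eventually.of_forall fun t => (integrable_conv ha hw t).aestronglyMeasurable) ?_
    ((ha.indicator _).norm.mul_const C) ?_
  · filter_upwards [Iio_mem_nhds (show t₀ < t₀ + 1 by linarith)] with t ht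
    refine Eventually.of_forall fun u => ?_
    rw [norm_smul]
    rcases lt_or_ge u 0 with hu | hu
    · rw [ha.zero u hu]; simp; positivity
    · by_cases h : u ≤ t₀ + 1
      · rw [indicator_of_mem (show u ∈ Iic (t₀ + 1) from h)]
        exact mul_le_mul_of_nonneg_left (hC _ (by linarith [mem_Iio.1 ht])) (norm_nonneg _)
      · rw [hw.zero (t - u) (by linarith [mem_Iio.1 ht])]; simp; positivity
  -- The factor w may jump at 0, which is felt only at u = t₀, a null set.
  · have : ∀ᵐ u : ℝ, u ≠ t₀ := by
      simp [ae_iff]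
    filter_upwards [this] with u hu
    have h1 : ContinuousAt w (t₀ - u) := hw.continuousAt (sub_ne_zero.2 (Ne.symm hu))
    exact continuousAt_const.smul (ContinuousAt.comp (f := fun t => t - u) h1 (by fun_prop))

theorem CausalCont.conv {a : ℝ → ℝ} {w : ℝ → E} (ha : CausalInt a) (hw : CausalCont w) :
    CausalCont (conv a w) :=
  .of_continuous (continuous_conv ha hw) fun _ ht => conv_zero_of_neg ha.zero hw.zero ht

theorem conv_nonpos {a : ℝ → ℝ} {w : ℝ → E} (ha : CausalInt a) (hw : CausalCont w)
    {t : ℝ} (ht : t ≤ 0) : DelayFDE.conv a w t = 0 := by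
  rcases lt_or_eq_of_le ht with h | rfl
  · exact conv_zero_of_neg ha.zero hw.zero h
  · rw [conv_eq_intervalIntegral le_rfl ha.zero hw.zero, intervalIntegral.integral_same]

/-- Dominated convergence: for fixed u, w(t - u) tends to 0. This lets integrable kernels act on
functions that vanish at infinity. -/
theorem tendsto_conv_atTop {a : ℝ → ℝ} {w : ℝ → E} (ha : Integrable a) (hw : CausalCont w)
    {C : ℝ} (hC : ∀ t, ‖w t‖ ≤ C) (hlim : Tendsto w atTop (𝓝 0)) :
    Tendsto (conv a w) atTop (𝓝 0) := by
  have : Tendsto (fun t => ∫ u, a u • w (t - u)) atTop (𝓝 (∫ _u : ℝ, (0 : E))) := by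
    refine tendsto_integral_filter_of_dominated_convergence (fun u => ‖a u‖ * C)
      (Eventually.of_forall fun t => ?_) (Eventually.of_forall fun t => ?_)
      (ha.norm.mul_const C) (Eventually.of_forall fun u => ?_)
    · exact ha.aestronglyMeasurable.smul (hw.stronglyMeasurable.comp_quasiMeasurePreserving
        (quasiMeasurePreserving_sub_left volume t))
    · refine Eventually.of_forall fun u => ?_
      rw [norm_smul]
      exact mul_le_mul_of_nonneg_left (hC _) (norm_nonneg _)
    · have h1 := (hlim.comp (tendsto_atTop_add_const_right atTop (-u) tendsto_id)).const_smul (a u)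
      simpa [Function.comp_def, sub_eq_add_neg] using h1
  rw [integral_zero] at this
  exact this

theorem conv_assoc [CompleteSpace E] {a b : ℝ → ℝ} {w : ℝ → E} (ha : CausalInt a)
    (hb : CausalInt b) (hw : CausalCont w) : conv (conv a b) w = conv a (conv b w) := by
  funext t
  have hz : ∀ {c : ℝ → ℝ}, CausalInt c → ∀ s < 0, (Iic t).indicator c s = 0 := fun hc s hs => by
    simp [indicator, hc.zero s hs]
  have hzw : ∀ s < 0, (Iic t).indicator w s = 0 := fun s hs => by
    simp [indicator, hw.zero s hs]
  have hea : EqOn a ((Iic t).indicator a) (Iic t) := fun s hs => (indicator_of_mem hs a).symm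
  have heb : EqOn b ((Iic t).indicator b) (Iic t) := fun s hs => (indicator_of_mem hs b).symm
  have hew : EqOn w ((Iic t).indicator w) (Iic t) := fun s hs => (indicator_of_mem hs w).symm
  obtain ⟨C, hC0, hC⟩ := hw.bound t
  have hCw : ∀ s, ‖(Iic t).indicator w s‖ ≤ C := fun s => by
    by_cases hs : s ≤ t
    · rw [indicator_of_mem (show s ∈ Iic t from hs)]; exact hC s hs
    · rw [indicator_of_notMem (by simpa using hs)]; simpa using hC0
  have hia := ha.indicator t
  have hib := hb.indicator t
  have hiw := hw.causalInt.indicator t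
  -- Cutting all three factors off at t does not change the values at t and makes them integrable,
  -- so that the general associativity of convolution applies.
  rw [conv_congr_of_le le_rfl (ha.conv hb).zero
    (fun s hs => conv_zero_of_neg (hz ha) (hz hb) hs) hw.zero hzw
    (fun s hs => conv_congr_of_le hs ha.zero (hz ha) hb.zero (hz hb) hea heb) hew,
    conv_congr_of_le le_rfl ha.zero (hz ha) (CausalCont.conv hb hw).zero
    (fun s hs => conv_zero_of_neg (hz hb) hzw hs) hea
    (fun s hs => conv_congr_of_le hs hb.zero (hz hb) hw.zero hzw heb hew)]
  simp only [conv_eq_convolution]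
  have hibw := hib.norm.integrable_convolution (ContinuousLinearMap.mul ℝ ℝ) hiw.norm
  refine convolution_assoc _ _ _ _ (fun x y z => by
    simp [smul_smul, mul_comm]) hia.aestronglyMeasurable
    hib.aestronglyMeasurable hiw.aestronglyMeasurable (hia.ae_convolution_exists _ hib)
    (hib.norm.ae_convolution_exists _ hiw.norm) ?_
  refine (BddAbove.convolutionExistsAt' _ (s := univ)
    ⟨(∫ u, ‖(Iic t).indicator b u‖) * C, ?_⟩ MeasurableSet.univ (fun _ _ => mem_univ _)
    hia.norm.integrableOn ?_)
  · rintro _ ⟨s, -, rfl⟩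
    have := norm_conv_le (a := fun u => ‖(Iic t).indicator b u‖)
      (w := fun u => ‖(Iic t).indicator w u‖) hib.norm (C := C) (fun s => by simpa using hCw s) s
    simpa [conv, convolution] using this
  · rw [Measure.restrict_univ]
    exact hibw.aestronglyMeasurable.mono_ac
      (quasiMeasurePreserving_sub_left volume t).absolutelyContinuous

theorem conv_left_comm [CompleteSpace E] {a b : ℝ → ℝ} {w : ℝ → E} (ha : CausalInt a)
    (hb : CausalInt b) (hw : CausalCont w) : conv a (conv b w) = conv b (conv a w) := by
  rw [← conv_assoc ha hb hw, conv_comm a b, conv_assoc hb ha hw]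

end Convolution

/-! ### Riemann–Liouville, tempered and correction kernels. -/

/-- The kernel `t ^ (β - 1) / Γ(β)` of the Riemann--Liouville integral. -/
noncomputable def rlKernel (β : ℝ) : ℝ → ℝ :=
  indicator (Ioi 0) fun t => t ^ (β - 1) / Real.Gamma β

/-- The tempered kernel `exp (-t) t ^ (β - 1) / Γ(β)`. -/
noncomputable def temperedKernel (β t : ℝ) : ℝ := Real.exp (-t) * rlKernel β t

/-- The kernel whose Laplace transform is `(1 + s) ^ α - s ^ α`. -/
noncomputable def correctionKernel (α t : ℝ) : ℝ :=
  α * rlKernel (1 - α) t * ((1 - Real.exp (-t)) / t)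

theorem rlKernel_of_pos {β t : ℝ} (ht : 0 < t) : rlKernel β t = t ^ (β - 1) / Real.Gamma β :=
  indicator_of_mem (mem_Ioi.2 ht) _

theorem rlKernel_of_nonpos {β t : ℝ} (ht : t ≤ 0) : rlKernel β t = 0 :=
  indicator_of_notMem (by simpa using ht) _

theorem rlKernel_nonneg {β : ℝ} (hβ : 0 < β) (t : ℝ) : 0 ≤ rlKernel β t := by
  rcases le_or_gt t 0 with ht | ht
  · rw [rlKernel_of_nonpos ht]
  · rw [rlKernel_of_pos ht]
    have := Real.Gamma_pos_of_pos hβ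
    positivity

theorem measurable_rlKernel (β : ℝ) : Measurable (rlKernel β) :=
  Measurable.indicator (by fun_prop) measurableSet_Ioi

theorem causalInt_rlKernel {β : ℝ} (hβ : 0 < β) : CausalInt (rlKernel β) := by
  refine .of_intervalIntegrable (fun t ht => rlKernel_of_nonpos ht.le) fun T hT => ?_
  have h := (intervalIntegral.intervalIntegrable_rpow' (a := 0) (b := T)
    (show -1 < β - 1 by linarith)).1.div_const (Real.Gamma β)
  exact IntegrableOn.congr_fun h (fun t ht => (rlKernel_of_pos ht.1).symm) measurableSet_Ioc

theorem temperedKernel_of_nonpos {β t : ℝ} (ht : t ≤ 0) : temperedKernel β t = 0 := by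
  rw [temperedKernel, rlKernel_of_nonpos ht, mul_zero]

theorem integrable_temperedKernel {β : ℝ} (hβ : 0 < β) : Integrable (temperedKernel β) := by
  have h := (Real.GammaIntegral_convergent hβ).div_const (Real.Gamma β)
  have h2 := (integrable_indicator_iff measurableSet_Ioi).2 h
  refine h2.congr (Eventually.of_forall fun t => ?_)
  rcases le_or_gt t 0 with ht | ht
  · rw [temperedKernel_of_nonpos ht, indicator_of_notMem (by simpa using ht)]
  · rw [temperedKernel, rlKernel_of_pos ht, indicator_of_mem (mem_Ioi.2 ht), mul_div_assoc]

theorem causalInt_temperedKernel {β : ℝ} (hβ : 0 < β) : CausalInt (temperedKernel β) :=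
  .of_integrable (integrable_temperedKernel hβ) fun _ ht => temperedKernel_of_nonpos ht.le

theorem temperedKernel_one {t : ℝ} (ht : 0 < t) : temperedKernel 1 t = Real.exp (-t) := by
  simp [temperedKernel, rlKernel_of_pos ht]

theorem rlIntegral_eq_conv {β : ℝ} (hβ1 : β < 1) {x y : ℝ → ℝ} (hy : ∀ t < 0, y t = 0) {t : ℝ}
    (ht : 0 ≤ t) (hxy : ∀ s ∈ Icc 0 t, x s = y s) :
    rlIntegral β x t = conv (rlKernel β) y t := by
  rw [conv_eq_intervalIntegral ht (fun t ht => rlKernel_of_nonpos ht.le) hy, rlIntegral,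
    ← intervalIntegral.integral_const_mul]
  refine intervalIntegral.integral_congr fun s hs => ?_
  rw [uIcc_of_le ht] at hs
  simp only [smul_eq_mul]
  rw [hxy s hs]
  rcases hs.2.lt_or_eq with h | rfl
  · rw [rlKernel_of_pos (sub_pos.2 h)]
    ring
  -- At s = t the default value 0 ^ (β - 1) = 0, valid since β ≠ 1, matches the value of the kernel
  -- at 0.
  · rw [rlKernel_of_nonpos (by simp), sub_self, Real.zero_rpow (by linarith)]
    ring

theorem integral_rpow_mul_sub_rpow {a b t : ℝ} (ha : 0 < a) (hb : 0 < b) (ht : 0 < t) :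
    ∫ x in (0 : ℝ)..t, x ^ (a - 1) * (t - x) ^ (b - 1) =
      t ^ (a + b - 1) * (Real.Gamma a * Real.Gamma b / Real.Gamma (a + b)) := by
  have h := Complex.betaIntegral_scaled a b ht
  rw [Complex.betaIntegral_eq_Gamma_mul_div _ _ (by simpa) (by simpa)] at h
  apply Complex.ofReal_injective
  rw [← intervalIntegral.integral_ofReal]
  push_cast
  rw [Complex.ofReal_cpow ht.le, ← Complex.Gamma_ofReal, ← Complex.Gamma_ofReal,
    ← Complex.Gamma_ofReal]
  push_cast
  rw [← h]
  refine intervalIntegral.integral_congr fun x hx => ?_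
  rw [uIcc_of_le ht.le] at hx
  rw [Complex.ofReal_cpow hx.1, Complex.ofReal_cpow (sub_nonneg.2 hx.2)]
  push_cast
  rfl

theorem conv_rlKernel {a b : ℝ} (ha : 0 < a) (hb : 0 < b) :
    conv (rlKernel a) (rlKernel b) = rlKernel (a + b) := by
  funext t
  have hz : ∀ β : ℝ, ∀ t < 0, rlKernel β t = 0 := fun β t ht => rlKernel_of_nonpos ht.le
  rcases lt_trichotomy t 0 with ht | rfl | ht
  · rw [conv_zero_of_neg (hz a) (hz b) ht, hz _ t ht]
  · rw [conv_eq_intervalIntegral le_rfl (hz a) (hz b), intervalIntegral.integral_same,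
      rlKernel_of_nonpos le_rfl]
  · rw [conv_comm, conv_eq_intervalIntegral ht.le (hz b) (hz a), rlKernel_of_pos ht]
    have hA := (Real.Gamma_pos_of_pos ha).ne'
    have hB := (Real.Gamma_pos_of_pos hb).ne'
    have key := integral_rpow_mul_sub_rpow ha hb ht
    have : ∫ s in (0 : ℝ)..t, rlKernel b (t - s) • rlKernel a s =
        ∫ s in (0 : ℝ)..t, (1 / (Real.Gamma a * Real.Gamma b)) *
          (s ^ (a - 1) * (t - s) ^ (b - 1)) := by
      refine intervalIntegral.integral_congr_Ioo_of_le ht.le fun s hs => ?_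
      simp only [smul_eq_mul]
      rw [rlKernel_of_pos hs.1, rlKernel_of_pos (sub_pos.2 hs.2)]
      field_simp
    rw [this, intervalIntegral.integral_const_mul, key]
    field_simp

theorem conv_temperedKernel {a b : ℝ} (ha : 0 < a) (hb : 0 < b) :
    conv (temperedKernel a) (temperedKernel b) = temperedKernel (a + b) := by
  funext t
  rw [temperedKernel, ← conv_rlKernel ha hb]
  simp only [conv, smul_eq_mul, temperedKernel]
  rw [← integral_const_mul]
  refine integral_congr_ae (Eventually.of_forall fun u => ?_)
  simp only
  have : Real.exp (-t) = Real.exp (-u) * Real.exp (-(t - u)) := by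
    rw [← Real.exp_add]; ring_nf
  rw [this]; ring

theorem correctionKernel_of_nonpos {α t : ℝ} (ht : t ≤ 0) : correctionKernel α t = 0 := by
  rw [correctionKernel, rlKernel_of_nonpos ht, mul_zero, zero_mul]

theorem one_sub_exp_neg_div_bounds {t : ℝ} (ht : 0 < t) :
    0 ≤ (1 - Real.exp (-t)) / t ∧ (1 - Real.exp (-t)) / t ≤ 1 ∧
      (1 - Real.exp (-t)) / t ≤ t⁻¹ := by
  have h1 := Real.add_one_le_exp (-t)
  have h2 : Real.exp (-t) ≤ 1 := Real.exp_le_one_iff.2 (by linarith)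
  refine ⟨div_nonneg (by linarith) ht.le, (div_le_one ht).2 (by linarith), ?_⟩
  rw [div_eq_mul_inv]
  exact mul_le_of_le_one_left (inv_nonneg.2 ht.le) (by linarith [Real.exp_pos (-t)])

theorem correctionKernel_nonneg {α : ℝ} (hα0 : 0 < α) (hα1 : α < 1) (t : ℝ) :
    0 ≤ correctionKernel α t := by
  rcases le_or_gt t 0 with ht | ht
  · rw [correctionKernel_of_nonpos ht]
  · exact mul_nonneg (mul_nonneg hα0.le (rlKernel_nonneg (by linarith) t))
      (one_sub_exp_neg_div_bounds ht).1

/-- The factor (1 - e^{-t})/t is at most 1, which handles the singularity t^{-α} at 0, and at most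
1/t, which gives the integrable tail t^{-1-α}. -/
theorem integrable_correctionKernel {α : ℝ} (hα0 : 0 < α) (hα1 : α < 1) :
    Integrable (correctionKernel α) := by
  have hm : Measurable (correctionKernel α) :=
    ((measurable_rlKernel _).const_mul α).mul (by fun_prop)
  have h1 : IntegrableOn (correctionKernel α) (Iic 1) := by
    refine Integrable.mono' (((causalInt_rlKernel (show 0 < 1 - α by linarith)).int 1).const_mul α)
      hm.aestronglyMeasurable (Eventually.of_forall fun t => ?_)
    rw [Real.norm_of_nonneg (correctionKernel_nonneg hα0 hα1 t)]
    rcases le_or_gt t 0 with ht | ht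
    · rw [correctionKernel_of_nonpos ht, rlKernel_of_nonpos ht, mul_zero]
    · exact mul_le_of_le_one_right (mul_nonneg hα0.le (rlKernel_nonneg (by linarith) t))
        (one_sub_exp_neg_div_bounds ht).2.1
  have h2 : IntegrableOn (correctionKernel α) (Ioi 1) := by
    refine Integrable.mono' ((integrableOn_Ioi_rpow_of_lt (show -1 - α < -1 by linarith)
      one_pos).const_mul (α / Real.Gamma (1 - α))) hm.aestronglyMeasurable ?_
    refine (ae_restrict_iff' measurableSet_Ioi).2 (Eventually.of_forall fun t ht => ?_)
    have ht0 : (0 : ℝ) < t := one_pos.trans ht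
    rw [Real.norm_of_nonneg (correctionKernel_nonneg hα0 hα1 t)]
    refine (mul_le_mul_of_nonneg_left (one_sub_exp_neg_div_bounds ht0).2.2
      (mul_nonneg hα0.le (rlKernel_nonneg (by linarith) t))).trans_eq ?_
    rw [rlKernel_of_pos ht0, show 1 - α - 1 = (-1 - α) + 1 by ring, Real.rpow_add_one ht0.ne']
    field_simp
  simpa using h1.union h2

theorem causalInt_correctionKernel {α : ℝ} (hα0 : 0 < α) (hα1 : α < 1) :
    CausalInt (correctionKernel α) :=
  .of_integrable (integrable_correctionKernel hα0 hα1) fun _ ht => correctionKernel_of_nonpos ht.le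

/-- The difference of the tempered kernel and the Riemann–Liouville kernel, (e^{-t} - 1)
t^{-α}/Γ(1-α), has as derivative the correction kernel minus the tempered one. It is O(t^{1-α}) at
0, hence continuous there although both terms blow up. On the transform side this is s^{α-1} + N/s =
(1 + s)^{α-1}(1 + 1/s). -/
theorem integral_correctionKernel {α : ℝ} (hα0 : 0 < α) (hα1 : α < 1) {t : ℝ} (ht : 0 < t) :
    rlKernel (1 - α) t + ∫ s in (0 : ℝ)..t, correctionKernel α s =
      temperedKernel (1 - α) t + ∫ s in (0 : ℝ)..t, temperedKernel (1 - α) s := by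
  have hn : IntervalIntegrable (correctionKernel α) volume 0 t :=
    (integrable_correctionKernel hα0 hα1).intervalIntegrable
  have hρ : IntervalIntegrable (temperedKernel (1 - α)) volume 0 t :=
    (integrable_temperedKernel (by linarith)).intervalIntegrable
  have hG : 0 < Real.Gamma (1 - α) := Real.Gamma_pos_of_pos (by linarith)
  have hder : ∀ s ∈ Ioo 0 t, HasDerivAt (fun s => temperedKernel (1 - α) s - rlKernel (1 - α) s)
      (correctionKernel α s - temperedKernel (1 - α) s) s := by
    intro s hs
    have h1 : HasDerivAt (fun s : ℝ => (Real.exp (-s) - 1) * (s ^ (1 - α - 1) / Real.Gamma (1 - α)))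
        ((Real.exp (-s) * -1) * (s ^ (1 - α - 1) / Real.Gamma (1 - α)) +
          (Real.exp (-s) - 1) * ((1 - α - 1) * s ^ (1 - α - 1 - 1) / Real.Gamma (1 - α))) s := by
      have h2 : HasDerivAt (fun s : ℝ => Real.exp (-s)) (Real.exp (-s) * -1) s :=
        (hasDerivAt_neg s).exp
      exact (h2.sub_const 1).mul ((Real.hasDerivAt_rpow_const (Or.inl hs.1.ne')).div_const _)
    have h3 := h1.congr_of_eventuallyEq
      (f₁ := fun s => temperedKernel (1 - α) s - rlKernel (1 - α) s) (by
        filter_upwards [Ioi_mem_nhds hs.1] with u hu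
        rw [temperedKernel, rlKernel_of_pos hu]; ring)
    refine h3.congr_deriv (Eq.symm ?_)
    rw [correctionKernel, temperedKernel, rlKernel_of_pos hs.1,
      Real.rpow_sub_one hs.1.ne' (1 - α - 1), Real.rpow_sub_one hs.1.ne' (1 - α)]
    have := hs.1.ne'
    field_simp
    ring
  have hcont : ContinuousOn (fun s => temperedKernel (1 - α) s - rlKernel (1 - α) s)
      (Icc 0 t) := by
    intro s hs
    rcases hs.1.eq_or_lt with rfl | h0
    · have hval : temperedKernel (1 - α) 0 - rlKernel (1 - α) 0 = 0 := by
        rw [temperedKernel_of_nonpos le_rfl, rlKernel_of_nonpos le_rfl, sub_self]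
      rw [ContinuousWithinAt, hval]
      have hlim : Tendsto (fun s : ℝ => s ^ (1 - α) / Real.Gamma (1 - α)) (𝓝[Icc 0 t] 0)
          (𝓝 0) := by
        have : ContinuousAt (fun s : ℝ => s ^ (1 - α) / Real.Gamma (1 - α)) 0 :=
          (Real.continuousAt_rpow_const _ _ (Or.inr (by linarith))).div_const _
        have h2 := this.tendsto
        simp only [Real.zero_rpow (show 1 - α ≠ 0 by linarith), zero_div] at h2
        exact h2.mono_left nhdsWithin_le_nhds
      refine squeeze_zero_norm' ?_ hlim
      filter_upwards [self_mem_nhdsWithin] with u hu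
      rcases hu.1.eq_or_lt with rfl | hu0
      · rw [hval, norm_zero]
        positivity
      · have hb := one_sub_exp_neg_div_bounds hu0
        have : temperedKernel (1 - α) u - rlKernel (1 - α) u =
            -((1 - Real.exp (-u)) / u * (u ^ (1 - α) / Real.Gamma (1 - α))) := by
          rw [temperedKernel, rlKernel_of_pos hu0, Real.rpow_sub_one hu0.ne']
          field_simp
          ring
        rw [this, norm_neg, Real.norm_of_nonneg (mul_nonneg hb.1 (by positivity))]
        exact mul_le_of_le_one_left (by positivity) hb.2.1
    · have hc : ContinuousAt (fun s => (Real.exp (-s) - 1) *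
          (s ^ (1 - α - 1) / Real.Gamma (1 - α))) s :=
        (by fun_prop : ContinuousAt (fun s => Real.exp (-s) - 1) s).mul
          ((Real.continuousAt_rpow_const _ _ (Or.inl h0.ne')).div_const _)
      refine (hc.congr ?_).continuousWithinAt
      filter_upwards [Ioi_mem_nhds h0] with u hu
      rw [temperedKernel, rlKernel_of_pos hu]; ring
  have key := intervalIntegral.integral_eq_sub_of_hasDerivAt_of_le ht.le hcont hder (hn.sub hρ)
  rw [intervalIntegral.integral_sub hn hρ, temperedKernel_of_nonpos le_rfl,
    rlKernel_of_nonpos le_rfl] at key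
  linarith

/-- The indicator of `[0, ∞)`, the kernel of integration. -/
noncomputable abbrev heaviside : ℝ → ℝ := indicator (Ici 0) 1

theorem causalInt_heaviside : CausalInt heaviside := causalCont_one.causalInt

theorem rlKernel_add_conv_correctionKernel {α : ℝ} (hα0 : 0 < α) (hα1 : α < 1) :
    (fun t => rlKernel (1 - α) t + conv heaviside (correctionKernel α) t) =
      fun t => temperedKernel (1 - α) t + conv heaviside (temperedKernel (1 - α)) t := by
  have h1 : ∀ t < 0, correctionKernel α t = 0 := fun t ht => correctionKernel_of_nonpos ht.le
  have h2 : ∀ t < 0, temperedKernel (1 - α) t = 0 := fun t ht => temperedKernel_of_nonpos ht.le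
  funext t
  rcases lt_trichotomy t 0 with ht | rfl | ht
  · rw [rlKernel_of_nonpos ht.le, temperedKernel_of_nonpos ht.le,
      conv_zero_of_neg causalInt_heaviside.zero h1 ht,
      conv_zero_of_neg causalInt_heaviside.zero h2 ht]
  · rw [conv_indicator_one h1 le_rfl, conv_indicator_one h2 le_rfl, rlKernel_of_nonpos le_rfl,
      temperedKernel_of_nonpos le_rfl]
    simp
  · rw [conv_indicator_one h1 ht.le, conv_indicator_one h2 ht.le]
    exact integral_correctionKernel hα0 hα1 ht

/-- For t > 0 this is e^{-t} + (1 - e^{-t}) = 1. It fails at t = 0, where the tempered kernel is 0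
by convention, hence the almost everywhere equality. -/
theorem temperedKernel_one_add_conv :
    (fun t => temperedKernel 1 t + conv heaviside (temperedKernel 1) t) =ᵐ[volume] heaviside := by
  have h2 : ∀ t < 0, temperedKernel 1 t = 0 := fun t ht => temperedKernel_of_nonpos ht.le
  have h0 : ∀ᵐ t : ℝ, t ≠ 0 := by simp [ae_iff]
  filter_upwards [h0] with t ht
  rcases lt_or_gt_of_ne ht with ht | ht
  · rw [h2 t ht, conv_zero_of_neg causalInt_heaviside.zero h2 ht]
    simp [heaviside, ht]
  · rw [conv_indicator_one h2 ht.le, temperedKernel_one ht]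
    have : ∫ s in (0 : ℝ)..t, temperedKernel 1 s = ∫ s in (0 : ℝ)..t, Real.exp (-s) :=
      intervalIntegral.integral_congr_Ioo_of_le ht.le fun s hs => temperedKernel_one hs.1
    rw [this]
    simp [heaviside, ht.le]

/-- `I^{1-α} z + I (n * z) = I w` for `z = q * w`, with `q` the tempered kernel of order `α` and
`n` the correction kernel. -/
theorem conv_rlKernel_conv_temperedKernel {E : Type*} [NormedAddCommGroup E] [NormedSpace ℝ E]
    [CompleteSpace E] {α : ℝ} (hα0 : 0 < α) (hα1 : α < 1) {w : ℝ → E} (hw : CausalCont w) (t : ℝ) :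
    conv (rlKernel (1 - α)) (conv (temperedKernel α) w) t +
      conv heaviside (conv (correctionKernel α) (conv (temperedKernel α) w)) t =
      conv heaviside w t := by
  have hα : 0 < 1 - α := by linarith
  have hq := causalInt_temperedKernel hα0
  have hρ := causalInt_temperedKernel hα
  have hk := causalInt_rlKernel hα
  have hn := causalInt_correctionKernel hα0 hα1
  have hH := causalInt_heaviside
  have he := causalInt_temperedKernel one_pos
  have hz := CausalCont.conv hq hw
  -- The sum k + H * n is replaced by ρ + H * ρ, with ρ tempered of order 1 - α. Then ρ * q is
  -- e^{-t}, and e^{-t} + H * e^{-t} = H.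
  rw [← conv_assoc hH hn hz, ← conv_add_left hk (hH.conv hn) hz,
    rlKernel_add_conv_correctionKernel hα0 hα1, conv_add_left hρ (hH.conv hρ) hz,
    conv_assoc hH hρ hz, ← conv_assoc hρ hq hw, conv_temperedKernel hα hα0,
    show 1 - α + α = 1 by ring, ← conv_assoc hH he hw, ← conv_add_left he (hH.conv he) hw,
    conv_congr_ae temperedKernel_one_add_conv]

/-! ### Laplace transforms of the kernels. -/

theorem norm_ofReal_mul_cexp (r : ℝ) (s : ℂ) (t : ℝ) :
    ‖(r : ℂ) * Complex.exp (-(s * t))‖ = |r| * Real.exp (-(s.re * t)) := by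
  rw [norm_mul, Complex.norm_exp, Complex.norm_real, Real.norm_eq_abs]
  simp

theorem integrable_rlKernel_mul_exp {β c : ℝ} (hβ : 0 < β) (hc : 0 < c) :
    Integrable fun t => rlKernel β t * Real.exp (-(c * t)) := by
  have h := (integrableOn_rpow_mul_exp_neg_mul_rpow (p := 1) (show -1 < β - 1 by linarith) one_pos
    hc).div_const (Real.Gamma β)
  refine ((integrable_indicator_iff measurableSet_Ioi).2 h).congr
    (Eventually.of_forall fun t => ?_)
  rcases le_or_gt t 0 with ht | ht
  · simp only [rlKernel_of_nonpos ht, zero_mul]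
    rw [indicator_of_notMem (by simpa using ht)]
  · simp only [rlKernel_of_pos ht, Real.rpow_one]
    rw [indicator_of_mem (mem_Ioi.2 ht)]
    ring_nf

theorem integral_rlKernel_mul_exp {β c : ℝ} (hβ : 0 < β) (hc : 0 < c) :
    ∫ t, rlKernel β t * Real.exp (-(c * t)) = c ^ (-β) := by
  have h := Real.integral_rpow_mul_exp_neg_mul_Ioi hβ hc
  have hG := (Real.Gamma_pos_of_pos hβ).ne'
  have h1 : ∫ t, rlKernel β t * Real.exp (-(c * t)) =
      ∫ t in Ioi 0, (1 / Real.Gamma β) * (t ^ (β - 1) * Real.exp (-(c * t))) := by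
    rw [← integral_indicator measurableSet_Ioi]
    refine integral_congr_ae (Eventually.of_forall fun t => ?_)
    rcases le_or_gt t 0 with ht | ht
    · simp only [rlKernel_of_nonpos ht, zero_mul]
      rw [indicator_of_notMem (by simpa using ht)]
    · simp only [rlKernel_of_pos ht]
      rw [indicator_of_mem (mem_Ioi.2 ht)]
      ring
  rw [h1, integral_const_mul, h, one_div c, Real.inv_rpow hc.le, ← Real.rpow_neg hc.le]
  field_simp

theorem integrable_rlKernel_mul_cexp {β : ℝ} (hβ : 0 < β) {s : ℂ} (hs : 0 < s.re) :
    Integrable fun t : ℝ => (rlKernel β t : ℂ) * Complex.exp (-(s * t)) := by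
  refine (integrable_rlKernel_mul_exp hβ hs).mono' ?_ (Eventually.of_forall fun t => ?_)
  · exact ((Complex.measurable_ofReal.comp (measurable_rlKernel β)).mul
      (by fun_prop)).aestronglyMeasurable
  · rw [norm_ofReal_mul_cexp, abs_of_nonneg (rlKernel_nonneg hβ t)]

/-- The Laplace transform of the kernel of the Riemann--Liouville integral. -/
theorem integral_rlKernel_mul_cexp {β : ℝ} (hβ : 0 < β) {s : ℂ} (hs : 0 < s.re) :
    ∫ t : ℝ, (rlKernel β t : ℂ) * Complex.exp (-(s * t)) = s ^ (-(β : ℂ)) := by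
  have hopen : IsOpen {z : ℂ | 0 < z.re} := isOpen_lt continuous_const Complex.continuous_re
  have hF : DifferentiableOn ℂ
      (fun s : ℂ => ∫ t : ℝ, (rlKernel β t : ℂ) * Complex.exp (-(s * t))) {z : ℂ | 0 < z.re} := by
    intro z hz
    have hz : 0 < z.re := hz
    refine DifferentiableAt.differentiableWithinAt (HasDerivAt.differentiableAt
      (hasDerivAt_integral_of_dominated_loc_of_deriv_le (s := {w : ℂ | z.re / 2 < w.re})
      (F' := fun w (t : ℝ) => (rlKernel β t : ℂ) * (Complex.exp (-(w * t)) * (-(1 * (t : ℂ)))))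
      (bound := fun t => β * (rlKernel (β + 1) t * Real.exp (-(z.re / 2 * t))))
      ?_ ?_ (integrable_rlKernel_mul_cexp hβ hz) ?_ ?_ ?_ ?_).2)
    · exact (isOpen_lt continuous_const Complex.continuous_re).mem_nhds
        (show z.re / 2 < z.re by linarith)
    · exact Eventually.of_forall fun w => ((Complex.measurable_ofReal.comp
        (measurable_rlKernel β)).mul (by fun_prop)).aestronglyMeasurable
    · exact ((Complex.measurable_ofReal.comp
        (measurable_rlKernel β)).mul (by fun_prop)).aestronglyMeasurable
    · refine Eventually.of_forall fun t w hw => ?_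
      have hw : z.re / 2 < w.re := hw
      rw [← mul_assoc, norm_mul, norm_ofReal_mul_cexp, abs_of_nonneg (rlKernel_nonneg hβ t)]
      rcases le_or_gt t 0 with ht | ht
      · simp [rlKernel_of_nonpos ht]
      · rw [rlKernel_of_pos ht, rlKernel_of_pos ht, Real.Gamma_add_one hβ.ne', one_mul, norm_neg,
          Complex.norm_real, Real.norm_of_nonneg ht.le, show β + 1 - 1 = β - 1 + 1 by ring,
          Real.rpow_add_one ht.ne']
        have hG := Real.Gamma_pos_of_pos hβ
        have he : Real.exp (-(w.re * t)) ≤ Real.exp (-(z.re / 2 * t)) :=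
          Real.exp_le_exp.2 (by nlinarith)
        calc t ^ (β - 1) / Real.Gamma β * Real.exp (-(w.re * t)) * t
            ≤ t ^ (β - 1) / Real.Gamma β * Real.exp (-(z.re / 2 * t)) * t := by gcongr
          _ = _ := by field_simp
    · exact (integrable_rlKernel_mul_exp (by linarith) (by linarith)).const_mul β
    · refine Eventually.of_forall fun t w _ => ?_
      exact (((hasDerivAt_id w).mul_const (t : ℂ)).neg.cexp).const_mul _
  have hG : DifferentiableOn ℂ (fun s : ℂ => s ^ (-(β : ℂ))) {z : ℂ | 0 < z.re} := by
    intro z hz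
    exact ((hasDerivAt_id z).cpow_const (Or.inl hz)).differentiableAt.differentiableWithinAt
  -- Identity theorem: both sides are holomorphic in the right half-plane and agree at positive
  -- reals, which accumulate at 1.
  refine (hF.analyticOnNhd hopen).eqOn_of_preconnected_of_frequently_eq (hG.analyticOnNhd hopen)
    (convex_halfSpace_re_gt 0).isPreconnected (z₀ := 1) (by simp) ?_ hs
  have hfr : ∃ᶠ x : ℝ in 𝓝[≠] 1, 0 < x := by
    refine Eventually.frequently ?_
    exact nhdsWithin_le_nhds (Ioi_mem_nhds one_pos)
  have hmap : Tendsto (fun x : ℝ => (x : ℂ)) (𝓝[≠] 1) (𝓝[≠] 1) := by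
    refine tendsto_nhdsWithin_iff.2 ⟨?_, ?_⟩
    · simpa using (Complex.continuous_ofReal.tendsto 1).mono_left nhdsWithin_le_nhds
    · filter_upwards [self_mem_nhdsWithin] with x hx
      simpa using hx
  refine hmap.frequently (hfr.mono fun x hx => ?_)
  have h := integral_rlKernel_mul_exp hβ hx
  have h2 : ((x ^ (-β) : ℝ) : ℂ) = (x : ℂ) ^ (-(β : ℂ)) := by
    rw [Complex.ofReal_cpow hx.le]; push_cast; rfl
  rw [← h2, ← h, ← integral_complex_ofReal]
  refine integral_congr_ae (Eventually.of_forall fun t => ?_)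
  push_cast
  rfl

theorem integral_temperedKernel_mul_cexp {β : ℝ} (hβ : 0 < β) {s : ℂ} (hs : 0 ≤ s.re) :
    ∫ t : ℝ, (temperedKernel β t : ℂ) * Complex.exp (-(s * t)) = (1 + s) ^ (-(β : ℂ)) := by
  rw [← integral_rlKernel_mul_cexp hβ (by simp; linarith)]
  refine integral_congr_ae (Eventually.of_forall fun t => ?_)
  simp only [temperedKernel]
  push_cast
  rw [show -((1 + s) * (t : ℂ)) = -t + -(s * t) by ring, Complex.exp_add]
  ring

/-- This is the Fubini hypothesis behind the transform of the correction kernel. The inner L¹ norm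
is (v + Re s)^{-(1-α)} ≤ v^{-(1-α)}, integrable at v = 0 even when Re s = 0. -/
theorem integrable_rlKernel_mul_cexp_prod {α : ℝ} (hα0 : 0 < α) (hα1 : α < 1) {s : ℂ}
    (hs : 0 ≤ s.re) :
    Integrable (Function.uncurry fun (v t : ℝ) =>
      (rlKernel (1 - α) t : ℂ) * Complex.exp (-((v + s) * t)))
      ((volume.restrict (Ioc 0 1)).prod volume) := by
  have hα : 0 < 1 - α := by linarith
  have hre : ∀ v : ℝ, 0 < v → 0 < ((v : ℂ) + s).re := fun v hv => by simp; linarith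
  have hmeas : Measurable (Function.uncurry fun (v t : ℝ) =>
      (rlKernel (1 - α) t : ℂ) * Complex.exp (-((v + s) * t))) :=
    (Complex.measurable_ofReal.comp ((measurable_rlKernel _).comp measurable_snd)).mul
      (by fun_prop)
  have hv : ∀ v ∈ Ioc (0 : ℝ) 1, Integrable fun t : ℝ =>
      (rlKernel (1 - α) t : ℂ) * Complex.exp (-((v + s) * t)) :=
    fun v hv => integrable_rlKernel_mul_cexp hα (hre v hv.1)
  have hn : ∀ v ∈ Ioc (0 : ℝ) 1, ∫ t : ℝ,
      ‖(rlKernel (1 - α) t : ℂ) * Complex.exp (-((v + s) * t))‖ ≤ v ^ (-(1 - α)) := by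
    intro v hv
    simp only [norm_ofReal_mul_cexp, abs_of_nonneg (rlKernel_nonneg hα _)]
    rw [integral_rlKernel_mul_exp hα (hre v hv.1)]
    exact Real.rpow_le_rpow_of_nonpos hv.1 (by simp; linarith) (by linarith)
  refine (integrable_prod_iff hmeas.aestronglyMeasurable).2 ⟨?_, ?_⟩
  · exact (ae_restrict_iff' measurableSet_Ioc).2 (Eventually.of_forall hv)
  · have h1 : IntegrableOn (fun v : ℝ => v ^ (-(1 - α))) (Ioc 0 1) :=
      (intervalIntegral.intervalIntegrable_rpow' (by linarith)).1
    refine Integrable.mono' h1 hmeas.norm.aestronglyMeasurable.integral_prod_right' ?_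
    refine (ae_restrict_iff' measurableSet_Ioc).2 (Eventually.of_forall fun v hv => ?_)
    rw [Real.norm_of_nonneg (integral_nonneg fun _ => norm_nonneg _)]
    exact hn v hv

/-- The Laplace transform of the correction kernel. -/
theorem integral_correctionKernel_mul_cexp {α : ℝ} (hα0 : 0 < α) (hα1 : α < 1) {s : ℂ}
    (hs : 0 ≤ s.re) :
    ∫ t : ℝ, (correctionKernel α t : ℂ) * Complex.exp (-(s * t)) =
      (1 + s) ^ (α : ℂ) - s ^ (α : ℂ) := by
  have hα : 0 < 1 - α := by linarith
  have hre : ∀ v : ℝ, 0 < v → 0 < ((v : ℂ) + s).re := fun v hv => by simp; linarith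
  have hint := integrable_rlKernel_mul_cexp_prod hα0 hα1 hs
  -- Here (1 - e^{-t})/t is written as the integral of e^{-vt} over 0 < v ≤ 1. The transform then
  -- becomes α ∫ (v + s)^{α-1} dv.
  have hsum : ∀ t : ℝ, (correctionKernel α t : ℂ) * Complex.exp (-(s * t)) =
      α * ∫ v in Ioc (0 : ℝ) 1, (rlKernel (1 - α) t : ℂ) * Complex.exp (-((v + s) * t)) := by
    intro t
    rcases le_or_gt t 0 with ht | ht
    · simp [correctionKernel_of_nonpos ht, rlKernel_of_nonpos ht]
    · have ht' : (t : ℂ) ≠ 0 := by exact_mod_cast ht.ne'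
      have h1 : ∀ v : ℝ, Complex.exp (-((v + s) * t)) =
          Complex.exp (-t * v) * Complex.exp (-(s * t)) := fun v => by
        rw [← Complex.exp_add]; ring_nf
      simp only [h1]
      rw [integral_const_mul, integral_mul_const, ← intervalIntegral.integral_of_le zero_le_one,
        integral_exp_mul_complex (by simpa using ht'), correctionKernel]
      push_cast
      simp only [mul_one, mul_zero, Complex.exp_zero]
      field_simp
      ring
  simp only [hsum]
  rw [integral_const_mul, ← integral_integral_swap hint]
  have hint' := hint.integral_prod_left
  have hval : ∀ v ∈ Ioc (0 : ℝ) 1, ∫ t : ℝ, (rlKernel (1 - α) t : ℂ) *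
      Complex.exp (-((v + s) * t)) = (v + s) ^ (-((1 - α : ℝ) : ℂ)) :=
    fun v hv => integral_rlKernel_mul_cexp hα (hre v hv.1)
  have hint2 : IntegrableOn (fun v : ℝ => ((v : ℂ) + s) ^ (-((1 - α : ℝ) : ℂ))) (Ioc 0 1) :=
    IntegrableOn.congr_fun hint' hval measurableSet_Ioc
  rw [setIntegral_congr_fun measurableSet_Ioc hval, ← intervalIntegral.integral_of_le zero_le_one]
  -- Differentiability is asked only for v > 0: at v = 0 the base s may be 0, where the power is
  -- merely continuous.
  have hder : ∀ v ∈ Ioo (0 : ℝ) 1, HasDerivAt (fun v : ℝ => ((v : ℂ) + s) ^ (α : ℂ))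
      (α * ((v : ℂ) + s) ^ (-((1 - α : ℝ) : ℂ))) v := by
    intro v hv
    have h1 : HasDerivAt (fun z : ℂ => (z + s) ^ (α : ℂ))
        (α * ((v : ℂ) + s) ^ ((α : ℂ) - 1) * 1) v :=
      ((hasDerivAt_id (v : ℂ)).add_const s).cpow_const (Or.inl (hre v hv.1))
    refine h1.comp_ofReal.congr_deriv ?_
    rw [mul_one]
    congr 2
    push_cast; ring
  have hcont : ContinuousOn (fun v : ℝ => ((v : ℂ) + s) ^ (α : ℂ)) (Icc 0 1) := by
    intro v hv
    refine ContinuousAt.continuousWithinAt ?_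
    refine ContinuousAt.comp (f := fun v : ℝ => (v : ℂ) + s) (g := fun z : ℂ => z ^ (α : ℂ))
      (Complex.continuousAt_cpow_const_of_re_pos (Or.inl ?_) (by simpa using hα0)) (by fun_prop)
    simp; linarith [hv.1]
  rw [← intervalIntegral.integral_const_mul,
    intervalIntegral.integral_eq_sub_of_hasDerivAt_of_le zero_le_one hcont hder
    (((intervalIntegrable_iff_integrableOn_Ioc_of_le zero_le_one).2 hint2).const_mul _)]
  simp

/-! ### Characteristic roots, and bounded multiplicative functions on the half-line. -/

theorem abs_arg_exp_le (z : ℂ) : |(Complex.exp z).arg| ≤ |z.im| := by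
  by_cases h : z.im ∈ Ioc (-Real.pi) Real.pi
  · rw [Complex.arg_exp, (toIocMod_eq_self Real.two_pi_pos).2 ⟨h.1, by linarith [h.2]⟩]
  · refine (Complex.abs_arg_le_pi _).trans ?_
    by_contra hlt
    push Not at hlt
    exact h ⟨(abs_lt.1 hlt).1, (abs_lt.1 hlt).2.le⟩

/-- The characteristic function `s ^ α - λ exp (-s τ)` has no zero in the closed right half-plane
when `λ` lies in the stability region. -/
theorem cpow_mul_exp_notMem_stabilityRegion {α τ : ℝ} (hα0 : 0 < α) (hτ : 0 < τ)
    {s : ℂ} (hs : 0 ≤ s.re) :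
    s ^ (α : ℂ) * Complex.exp (s * τ) ∉ stabilityRegion α τ := by
  rintro ⟨h0, hlt, harg, -⟩
  have hs0 : s ≠ 0 := by
    rintro rfl
    exact h0 (by rw [Complex.zero_cpow (by exact_mod_cast hα0.ne'), zero_mul])
  have hpos : 0 < ‖s‖ := norm_pos_iff.2 hs0
  set z := s ^ (α : ℂ) * Complex.exp (s * τ) with hz
  have hze : z = Complex.exp (Complex.log s * α + s * τ) := by
    rw [hz, Complex.cpow_def_of_ne_zero hs0, Complex.exp_add]
  -- Since Re s ≥ 0, the factor e^{sτ} has modulus at least 1. With |arg z| ≤ απ/2 + τ|s| below,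
  -- this contradicts the inequality that defines the region.
  have hnorm : ‖s‖ ^ α ≤ ‖z‖ := by
    rw [hz, norm_mul, Complex.norm_exp, Complex.norm_cpow_of_ne_zero hs0]
    simp only [Complex.ofReal_re, Complex.ofReal_im, mul_zero, Real.exp_zero, div_one]
    refine le_mul_of_one_le_right (by positivity) (Real.one_le_exp ?_)
    simp; positivity
  have h1 : ‖s‖ < (|z.arg| - α * Real.pi / 2) / τ := by
    have hb : 0 ≤ (|z.arg| - α * Real.pi / 2) / τ := div_nonneg (by linarith) hτ.le
    exact (Real.rpow_lt_rpow_iff hpos.le hb hα0).1 (hnorm.trans_lt hlt)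
  have h2 : |z.arg| ≤ α * (Real.pi / 2) + ‖s‖ * τ := by
    rw [hze]
    refine (abs_arg_exp_le _).trans ?_
    simp only [Complex.add_im, Complex.mul_im, Complex.log_im, Complex.ofReal_re,
      Complex.ofReal_im, mul_zero, zero_add]
    refine (abs_add_le _ _).trans ?_
    rw [abs_mul, abs_mul, abs_of_pos hα0, abs_of_pos hτ, mul_comm]
    gcongr
    · exact Complex.abs_arg_le_pi_div_two_iff.2 hs
    · exact Complex.abs_im_le_norm s
  rw [lt_div_iff₀ hτ] at h1
  linarith

/-- A bounded continuous multiplicative function on `[0, ∞)` with nonzero Laplace transform at `1`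
is `u ↦ exp (-s u)` with `0 ≤ Re s`. -/
theorem exists_eq_exp_of_mul {m : ℝ → ℂ} (hcont : Continuous m)
    (hmul : ∀ u v, 0 ≤ u → 0 ≤ v → m (u + v) = m u * m v) {C : ℝ} (hC : ∀ u, ‖m u‖ ≤ C)
    (hr : ∫ u in Ioi (0 : ℝ), Complex.exp (-u) * m u ≠ 0) :
    ∃ s : ℂ, 0 ≤ s.re ∧ ∀ u, 0 ≤ u → m u = Complex.exp (-(s * u)) := by
  set r := ∫ u in Ioi (0 : ℝ), Complex.exp (-u) * m u with hrdef
  have hf : Continuous fun u : ℝ => Complex.exp (-u) * m u := by fun_prop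
  have hint : IntegrableOn (fun u : ℝ => Complex.exp (-u) * m u) (Ioi 0) := by
    refine ((integrableOn_exp_neg_Ioi 0).mul_const C).mono' hf.aestronglyMeasurable
      (Eventually.of_forall fun u => ?_)
    rw [norm_mul, Complex.norm_exp]
    simpa using mul_le_mul_of_nonneg_left (hC u) (Real.exp_pos (-u)).le
  have htail : ∀ h : ℝ, 0 ≤ h → Complex.exp (-h) * m h * r =
      r - ∫ u in (0 : ℝ)..h, Complex.exp (-u) * m u := by
    intro h hh
    have e1 : ∫ u in Ioi (0 : ℝ), Complex.exp (-(u + h : ℝ)) * m (u + h) =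
        ∫ u in Ioi h, Complex.exp (-u) * m u := by
      rw [← integral_indicator measurableSet_Ioi, ← integral_indicator measurableSet_Ioi,
        ← integral_add_right_eq_self ((Ioi h).indicator fun u : ℝ => Complex.exp (-u) * m u) h]
      refine integral_congr_ae (Eventually.of_forall fun u => ?_)
      simp [indicator]
    have e2 : ∫ u in Ioi (0 : ℝ), Complex.exp (-(u + h : ℝ)) * m (u + h) =
        Complex.exp (-h) * m h * r := by
      rw [hrdef, ← integral_const_mul]
      refine setIntegral_congr_fun measurableSet_Ioi fun u hu => ?_
      rw [hmul u h (mem_Ioi.1 hu).le hh]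
      push_cast
      rw [show -((u : ℂ) + h) = -u + -h by ring, Complex.exp_add]
      ring
    rw [← e2, e1, intervalIntegral.integral_of_le hh, hrdef,
      ← Ioc_union_Ioi_eq_Ioi hh, setIntegral_union (Ioc_disjoint_Ioi le_rfl) measurableSet_Ioi
      (hint.mono_set Ioc_subset_Ioi_self) (hint.mono_set (Ioi_subset_Ioi hh))]
    ring
  set G : ℝ → ℂ := fun h => r - ∫ u in (0 : ℝ)..h, Complex.exp (-u) * m u with hG
  have hGd : ∀ h : ℝ, HasDerivAt G (-(Complex.exp (-h) * m h)) h := fun h => by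
    have := intervalIntegral.integral_hasDerivAt_right (hf.intervalIntegrable 0 h)
      (hf.stronglyMeasurableAtFilter _ _) hf.continuousAt
    simpa using this.const_sub r
  have hval : ∀ h : ℝ, 0 ≤ h → G h = r * Complex.exp (-(r⁻¹ * h)) := by
    intro h hh
    have hconst := constant_of_has_deriv_right_zero (f := fun x : ℝ => G x * Complex.exp (r⁻¹ * x))
      (a := 0) (b := h) ?_ ?_ h ⟨hh, le_rfl⟩
    · have hG0 : G 0 = r := by simp [hG]
      simp only [hG0, Complex.ofReal_zero, mul_zero, Complex.exp_zero, mul_one] at hconst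
      rw [Complex.exp_neg, eq_mul_inv_iff_mul_eq₀ (Complex.exp_ne_zero _)]
      exact hconst
    · refine Continuous.continuousOn (Continuous.mul ?_ (by fun_prop))
      exact continuous_iff_continuousAt.2 fun x => (hGd x).continuousAt
    · intro x hx
      have he : HasDerivAt (fun x : ℝ => Complex.exp (r⁻¹ * x))
          (Complex.exp (r⁻¹ * x) * (r⁻¹ * 1)) x :=
        (((hasDerivAt_id (x : ℂ)).const_mul r⁻¹).cexp).comp_ofReal
      have h1 := (hGd x).mul he
      refine (h1.congr_deriv ?_).hasDerivWithinAt
      have h2 : G x = Complex.exp (-x) * m x * r := (htail x hx.1).symm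
      rw [h2]
      field_simp
      ring
  have hm : ∀ u : ℝ, 0 ≤ u → m u = Complex.exp (-((r⁻¹ - 1) * u)) := by
    intro u hu
    have h1 := (htail u hu).trans (hval u hu)
    have h2 : Complex.exp (-u) * m u = Complex.exp (-(r⁻¹ * u)) :=
      mul_right_cancel₀ hr (by rw [h1, mul_comm])
    rw [show -((r⁻¹ - 1) * (u : ℂ)) = u + -(r⁻¹ * u) by ring, Complex.exp_add, ← h2, ← mul_assoc,
      ← Complex.exp_add]
    simp
  -- The transform of e^{-su} at 1 is r = 1/(1 + s). A negative real part of s would make m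
  -- unbounded.
  refine ⟨r⁻¹ - 1, ?_, hm⟩
  by_contra hneg
  push Not at hneg
  set c := -(r⁻¹ - 1).re with hc
  have hc0 : 0 < c := by rw [hc]; linarith
  have hb : ∀ u : ℝ, 0 ≤ u → c * u + 1 ≤ C := by
    intro u hu
    have h1 := hC u
    rw [hm u hu, Complex.norm_exp] at h1
    have h2 : (-((r⁻¹ - 1) * (u : ℂ))).re = c * u := by
      rw [hc, Complex.neg_re, Complex.re_mul_ofReal, neg_mul]
    rw [h2] at h1
    exact (Real.add_one_le_exp _).trans h1
  have hC1 := hb 0 le_rfl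
  have := hb (C / c) (div_nonneg (by linarith) hc0.le)
  rw [mul_div_cancel₀ _ hc0.ne'] at this
  linarith

/-! ### The space of decaying functions, with its convolutions and shifts. -/

/-- Bounded continuous functions vanishing on `(-∞, 0]` and tending to `0` at infinity. -/
def decaySubmodule : Submodule ℂ (BoundedContinuousFunction ℝ ℂ) where
  carrier := {f | (∀ t ≤ 0, f t = 0) ∧ Tendsto f atTop (𝓝 0)}
  zero_mem' := ⟨fun _ _ => rfl, tendsto_const_nhds⟩
  add_mem' := fun {f g} hf hg => ⟨fun t ht => by simp [hf.1 t ht, hg.1 t ht], by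
    have h := hf.2.add hg.2
    rw [add_zero] at h
    exact h⟩
  smul_mem' := fun c f hf => ⟨fun t ht => by simp [hf.1 t ht], by
    have h := hf.2.const_smul c
    rw [smul_zero] at h
    exact h⟩

theorem isClosed_decaySubmodule :
    IsClosed (decaySubmodule : Set (BoundedContinuousFunction ℝ ℂ)) := by
  refine isClosed_of_closure_subset fun f hf => ?_
  rw [Metric.mem_closure_iff] at hf
  refine ⟨fun t ht => ?_, ?_⟩
  · refine norm_le_zero_iff.1 (le_of_forall_pos_le_add fun ε hε => ?_)
    obtain ⟨g, hg, hfg⟩ := hf ε hε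
    have h := (BoundedContinuousFunction.dist_coe_le_dist t).trans hfg.le
    rw [dist_eq_norm, hg.1 t ht, sub_zero] at h
    linarith
  · rw [Metric.tendsto_atTop]
    intro ε hε
    obtain ⟨g, hg, hfg⟩ := hf (ε / 2) (half_pos hε)
    obtain ⟨N, hN⟩ := Metric.tendsto_atTop.1 hg.2 (ε / 2) (half_pos hε)
    refine ⟨N, fun t ht => ?_⟩
    have h := (BoundedContinuousFunction.dist_coe_le_dist (f := f) (g := g) t).trans_lt hfg
    linarith [dist_triangle (f t) (g t) 0, hN t ht]

/-- The Banach space of continuous functions vanishing on `(-∞, 0]` and at infinity. -/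
def DecaySpace : Type := decaySubmodule

noncomputable instance : NormedAddCommGroup DecaySpace :=
  inferInstanceAs (NormedAddCommGroup decaySubmodule)

noncomputable instance : NormedSpace ℂ DecaySpace :=
  inferInstanceAs (NormedSpace ℂ decaySubmodule)

instance : CompleteSpace DecaySpace :=
  isClosed_decaySubmodule.completeSpace_coe

namespace DecaySpace

noncomputable instance : CoeFun DecaySpace fun _ => ℝ → ℂ := ⟨fun f => f.1⟩

/-- The element of `DecaySpace` given by a function. -/
noncomputable def ofFun (f : ℝ → ℂ) (hc : Continuous f) (h0 : ∀ t ≤ 0, f t = 0)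
    (hl : Tendsto f atTop (𝓝 0)) (C : ℝ) (hC : ∀ t, ‖f t‖ ≤ C) : DecaySpace :=
  ⟨BoundedContinuousFunction.ofNormedAddCommGroup f hc C hC, h0, hl⟩

theorem continuous (f : DecaySpace) : Continuous f := f.1.continuous

theorem tendsto (f : DecaySpace) : Tendsto f atTop (𝓝 0) := f.2.2

theorem causalCont (f : DecaySpace) : CausalCont f :=
  .of_continuous f.continuous fun t ht => f.2.1 t ht.le

theorem norm_apply_le (f : DecaySpace) (t : ℝ) : ‖f t‖ ≤ ‖f‖ :=
  BoundedContinuousFunction.norm_coe_le_norm f.1 t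

theorem norm_le {f : DecaySpace} {C : ℝ} (hC : 0 ≤ C) (h : ∀ t, ‖f t‖ ≤ C) : ‖f‖ ≤ C :=
  (BoundedContinuousFunction.norm_le hC).2 h

theorem ext {f g : DecaySpace} (h : ∀ t, f t = g t) : f = g :=
  Subtype.ext (BoundedContinuousFunction.ext h)

/-- Evaluation at a point. -/
noncomputable def evalCLM (t : ℝ) : DecaySpace →L[ℂ] ℂ :=
  (BoundedContinuousFunction.evalCLM ℂ t).comp decaySubmodule.subtypeL

end DecaySpace

/-- Integrable convolution kernels vanishing on the negative half-line. -/
structure IntegrableKernel (a : ℝ → ℝ) : Prop where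
  integrable : Integrable a
  zero : ∀ t < 0, a t = 0

theorem IntegrableKernel.causalInt {a : ℝ → ℝ} (h : IntegrableKernel a) : CausalInt a :=
  .of_integrable h.integrable h.zero

theorem integrableKernel_temperedKernel {β : ℝ} (hβ : 0 < β) :
    IntegrableKernel (temperedKernel β) :=
  ⟨integrable_temperedKernel hβ, fun _ ht => temperedKernel_of_nonpos ht.le⟩

theorem integrableKernel_correctionKernel {α : ℝ} (hα0 : 0 < α) (hα1 : α < 1) :
    IntegrableKernel (correctionKernel α) :=
  ⟨integrable_correctionKernel hα0 hα1, fun _ ht => correctionKernel_of_nonpos ht.le⟩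

/-- Convolution with an integrable kernel as an operator on `DecaySpace`. -/
noncomputable def convOp {a : ℝ → ℝ} (h : IntegrableKernel a) : DecaySpace →L[ℂ] DecaySpace :=
  LinearMap.mkContinuous
    { toFun := fun f => DecaySpace.ofFun (conv a f) (continuous_conv h.causalInt f.causalCont)
        (fun _ ht => conv_nonpos h.causalInt f.causalCont ht)
        (tendsto_conv_atTop h.integrable f.causalCont f.norm_apply_le f.tendsto) _
        (norm_conv_le h.integrable f.norm_apply_le)
      map_add' := fun f g => DecaySpace.ext fun t =>
        conv_add_right h.causalInt f.causalCont g.causalCont t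
      map_smul' := fun c f => DecaySpace.ext fun t => conv_smul_right a c f t }
    (∫ u, ‖a u‖) fun f => DecaySpace.norm_le
      (mul_nonneg (integral_nonneg fun _ => norm_nonneg _) (norm_nonneg _))
      (norm_conv_le h.integrable f.norm_apply_le)

/-- Translation to the right by `|u|` as an operator on `DecaySpace`. -/
noncomputable def shiftOp (u : ℝ) : DecaySpace →L[ℂ] DecaySpace :=
  LinearMap.mkContinuous
    { toFun := fun f => DecaySpace.ofFun (fun t => f (t - |u|)) (f.continuous.comp (by fun_prop))
        (fun t ht => f.2.1 _ (by linarith [abs_nonneg u]))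
        (f.tendsto.comp (tendsto_atTop_add_const_right atTop (-|u|) tendsto_id)) ‖f‖
        (fun t => f.norm_apply_le _)
      map_add' := fun f g => rfl
      map_smul' := fun c f => rfl }
    1 fun f => by
      rw [one_mul]
      exact DecaySpace.norm_le (norm_nonneg _) fun t => f.norm_apply_le _

theorem norm_shiftOp_le (u : ℝ) : ‖shiftOp u‖ ≤ 1 :=
  LinearMap.mkContinuous_norm_le _ zero_le_one _

theorem shiftOp_add {u v : ℝ} (hu : 0 ≤ u) (hv : 0 ≤ v) :
    shiftOp (u + v) = shiftOp u * shiftOp v := by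
  refine ContinuousLinearMap.ext fun f => DecaySpace.ext fun t => ?_
  change f (t - |u + v|) = f (t - |u| - |v|)
  rw [abs_of_nonneg hu, abs_of_nonneg hv, abs_of_nonneg (add_nonneg hu hv), sub_sub]

theorem shiftOp_comm (u v : ℝ) : shiftOp u * shiftOp v = shiftOp v * shiftOp u := by
  refine ContinuousLinearMap.ext fun f => DecaySpace.ext fun t => ?_
  change f (t - |u| - |v|) = f (t - |v| - |u|)
  rw [sub_right_comm]

theorem convOp_comm {a b : ℝ → ℝ} (ha : IntegrableKernel a) (hb : IntegrableKernel b) :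
    convOp ha * convOp hb = convOp hb * convOp ha := by
  refine ContinuousLinearMap.ext fun f => DecaySpace.ext fun t => ?_
  exact congrFun (conv_left_comm ha.causalInt hb.causalInt f.causalCont) t

theorem shiftOp_convOp_comm (u : ℝ) {a : ℝ → ℝ} (ha : IntegrableKernel a) :
    shiftOp u * convOp ha = convOp ha * shiftOp u := by
  refine ContinuousLinearMap.ext fun f => DecaySpace.ext fun t => ?_
  change conv a f (t - |u|) = conv a (fun t => f (t - |u|)) t
  simp only [conv, sub_right_comm]

theorem convOp_temperedKernel_mul {a b : ℝ} (ha : 0 < a) (hb : 0 < b) (hab : 0 < a + b) :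
    convOp (integrableKernel_temperedKernel ha) * convOp (integrableKernel_temperedKernel hb) =
      convOp (integrableKernel_temperedKernel hab) := by
  refine ContinuousLinearMap.ext fun f => DecaySpace.ext fun t => ?_
  change conv (temperedKernel a) (conv (temperedKernel b) f) t = conv (temperedKernel (a + b)) f t
  rw [← conv_temperedKernel ha hb,
    conv_assoc (causalInt_temperedKernel ha) (causalInt_temperedKernel hb) f.causalCont]

/-! ### The commutative Banach algebra of convolutions and shifts. -/

/-- The generators of the convolution algebra. -/
def convGenerators : Set (DecaySpace →L[ℂ] DecaySpace) :=
  {T | ∃ (a : ℝ → ℝ) (h : IntegrableKernel a), T = convOp h} ∪ range shiftOp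

theorem convGenerators_comm : ∀ S ∈ convGenerators, ∀ T ∈ convGenerators, S * T = T * S := by
  rintro S (⟨a, ha, rfl⟩ | ⟨u, rfl⟩) T (⟨b, hb, rfl⟩ | ⟨v, rfl⟩)
  · exact convOp_comm ha hb
  · exact (shiftOp_convOp_comm v ha).symm
  · exact shiftOp_convOp_comm u hb
  · exact shiftOp_comm u v

/-- The commutative Banach algebra of operators generated by convolutions and shifts. -/
noncomputable def convAlgebra : Subalgebra ℂ (DecaySpace →L[ℂ] DecaySpace) :=
  (Algebra.adjoin ℂ convGenerators).topologicalClosure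

theorem convAlgebra_mul_comm (S T : convAlgebra) : S * T = T * S := by
  have hc := Algebra.isMulCommutative_adjoin ℂ convGenerators_comm
  exact (Subalgebra.commRingTopologicalClosure (Algebra.adjoin ℂ convGenerators)
    (fun x y => hc.is_comm.comm x y)).mul_comm S T

/-- The commutative Banach algebra `convAlgebra` as a type. -/
def ConvAlgebra : Type := convAlgebra

noncomputable instance : NormedCommRing ConvAlgebra :=
  { (inferInstanceAs (NormedRing convAlgebra) : NormedRing ConvAlgebra) with
    mul_comm := convAlgebra_mul_comm }

noncomputable instance : NormedAlgebra ℂ ConvAlgebra :=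
  { (inferInstanceAs (Algebra ℂ convAlgebra) : Algebra ℂ ConvAlgebra) with
    norm_smul_le := fun c (T : convAlgebra) => norm_smul_le c T.1 }

instance : CompleteSpace ConvAlgebra :=
  (Subalgebra.isClosed_topologicalClosure (Algebra.adjoin ℂ convGenerators)).completeSpace_coe

/-- The operator given by an element of the convolution algebra. -/
noncomputable def ConvAlgebra.toOp : ConvAlgebra →L[ℂ] (DecaySpace →L[ℂ] DecaySpace) :=
  LinearMap.mkContinuous
    { toFun := fun T => T.1
      map_add' := fun _ _ => rfl
      map_smul' := fun _ _ => rfl } 1 fun T => (one_mul ‖T‖).symm.le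

theorem ConvAlgebra.toOp_injective : Function.Injective ConvAlgebra.toOp :=
  fun _ _ h => Subtype.ext h

theorem ConvAlgebra.toOp_one : ConvAlgebra.toOp 1 = 1 := rfl

theorem ConvAlgebra.toOp_mul (S T : ConvAlgebra) :
    ConvAlgebra.toOp (S * T) = ConvAlgebra.toOp S * ConvAlgebra.toOp T := rfl

/-- Convolution as an element of the convolution algebra. -/
noncomputable def convElt {a : ℝ → ℝ} (h : IntegrableKernel a) : ConvAlgebra :=
  ⟨convOp h, Subalgebra.le_topologicalClosure _ (Algebra.subset_adjoin (Or.inl ⟨a, h, rfl⟩))⟩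

/-- Translation as an element of the convolution algebra. -/
noncomputable def shiftElt (u : ℝ) : ConvAlgebra :=
  ⟨shiftOp u, Subalgebra.le_topologicalClosure _ (Algebra.subset_adjoin (Or.inr ⟨u, rfl⟩))⟩

/-- Convolution with `exp (-t)`. -/
noncomputable def resolventElt : ConvAlgebra := convElt (integrableKernel_temperedKernel one_pos)

/-- Convolution with e^{-t} solves y' + y = f, y(0) = 0. The integrated form shows that its image
consists of Lipschitz functions, with constant controlled by ‖f‖. -/
theorem convOp_temperedKernel_one_apply_eq (f : DecaySpace) (t : ℝ) :
    convOp (integrableKernel_temperedKernel one_pos) f t =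
      ∫ s in (0 : ℝ)..t, (f s - convOp (integrableKernel_temperedKernel one_pos) f s) := by
  set g := convOp (integrableKernel_temperedKernel one_pos) f with hg
  have hH := causalInt_heaviside
  have he := causalInt_temperedKernel one_pos
  rcases lt_or_ge t 0 with ht | ht
  · rw [g.2.1 t ht.le, intervalIntegral.integral_symm, intervalIntegral.integral_zero_ae, neg_zero]
    refine Eventually.of_forall fun s hs => ?_
    rw [uIoc_of_le ht.le] at hs
    rw [f.2.1 s hs.2, g.2.1 s hs.2, sub_zero]
  · rw [← conv_indicator_one (f.causalCont.sub g.causalCont).zero ht,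
      conv_sub_right hH f.causalCont g.causalCont]
    have h := conv_congr_ae temperedKernel_one_add_conv f
    have h1 := congrFun h t
    rw [conv_add_left he (hH.conv he) f.causalCont, conv_assoc hH he f.causalCont] at h1
    exact eq_sub_of_add_eq h1

/-- Shifts form only a strongly continuous family. After composition with the resolvent, whose image
is Lipschitz uniformly on the unit ball, the family becomes Lipschitz in operator norm. -/
theorem continuous_shiftElt_mul_resolventElt :
    Continuous fun u => shiftElt u * resolventElt := by
  set R := convOp (integrableKernel_temperedKernel one_pos) with hR
  have hlip : ∀ (f : DecaySpace) (t t' : ℝ), ‖R f t - R f t'‖ ≤ (1 + ‖R‖) * ‖f‖ * |t - t'| := by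
    intro f t t'
    have hc : Continuous fun s => f s - R f s := f.continuous.sub (R f).continuous
    rw [convOp_temperedKernel_one_apply_eq f t, convOp_temperedKernel_one_apply_eq f t',
      intervalIntegral.integral_interval_sub_left (hc.intervalIntegrable _ _)
      (hc.intervalIntegrable _ _)]
    refine intervalIntegral.norm_integral_le_of_norm_le_const fun s _ => ?_
    calc ‖f s - R f s‖ ≤ ‖f s‖ + ‖R f s‖ := norm_sub_le _ _
      _ ≤ ‖f‖ + ‖R‖ * ‖f‖ := add_le_add (f.norm_apply_le s)
        (((R f).norm_apply_le s).trans (R.le_opNorm f))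
      _ = (1 + ‖R‖) * ‖f‖ := by ring
  have hC : 0 ≤ 1 + ‖R‖ := by positivity
  refine (LipschitzWith.of_dist_le_mul (K := ⟨1 + ‖R‖, hC⟩) fun u v => ?_).continuous
  rw [dist_eq_norm]
  change ‖shiftOp u * R - shiftOp v * R‖ ≤ (1 + ‖R‖) * dist u v
  refine ContinuousLinearMap.opNorm_le_bound _ (by positivity) fun f => ?_
  refine DecaySpace.norm_le (by positivity) fun t => ?_
  change ‖R f (t - |u|) - R f (t - |v|)‖ ≤ _
  refine (hlip f _ _).trans ?_
  have h1 : |t - |u| - (t - |v|)| ≤ dist u v := by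
    rw [show t - |u| - (t - |v|) = |v| - |u| by ring, dist_comm, Real.dist_eq]
    exact abs_abs_sub_abs_le_abs_sub v u
  calc (1 + ‖R‖) * ‖f‖ * |t - |u| - (t - |v|)| ≤ (1 + ‖R‖) * ‖f‖ * dist u v := by gcongr
    _ = _ := by ring

theorem norm_shiftElt_le (u : ℝ) : ‖shiftElt u‖ ≤ 1 := norm_shiftOp_le u

theorem integrable_smul_shiftElt_mul_resolventElt {a : ℝ → ℝ} (h : IntegrableKernel a) :
    Integrable fun u => (a u : ℂ) • (shiftElt u * resolventElt) := by
  refine Integrable.mono' (g := fun u => ‖a u‖ * ‖resolventElt‖)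
    (h.integrable.norm.mul_const _) ?_ (Eventually.of_forall fun u => ?_)
  · exact (Complex.continuous_ofReal.comp_aestronglyMeasurable
      h.integrable.aestronglyMeasurable).smul
      continuous_shiftElt_mul_resolventElt.aestronglyMeasurable
  · rw [norm_smul, Complex.norm_real]
    refine mul_le_mul_of_nonneg_left ?_ (norm_nonneg _)
    refine (norm_mul_le _ _).trans ?_
    exact mul_le_of_le_one_left (norm_nonneg _) (norm_shiftElt_le u)

/-- A convolution is a superposition of shifts. The resolvent factor makes this a norm-convergent
Bochner integral in the algebra, through which a character can be passed. Equality is tested by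
evaluation at f and t. -/
theorem convElt_mul_resolventElt {a : ℝ → ℝ} (h : IntegrableKernel a) :
    convElt h * resolventElt = ∫ u, (a u : ℂ) • (shiftElt u * resolventElt) := by
  refine ConvAlgebra.toOp_injective
    (ContinuousLinearMap.ext fun f => DecaySpace.ext fun t => ?_)
  let L : ConvAlgebra →L[ℂ] ℂ :=
    ((DecaySpace.evalCLM t).comp (ContinuousLinearMap.apply ℂ DecaySpace f)).comp
      ConvAlgebra.toOp
  have h1 := L.integral_comp_comm (integrable_smul_shiftElt_mul_resolventElt h)
  change conv a (convOp (integrableKernel_temperedKernel one_pos) f) t = L _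
  rw [← h1]
  refine integral_congr_ae (Eventually.of_forall fun u => ?_)
  simp only [map_smul]
  change a u • convOp (integrableKernel_temperedKernel one_pos) f (t - u) =
    (a u : ℂ) • convOp (integrableKernel_temperedKernel one_pos) f (t - |u|)
  rcases lt_or_ge u 0 with hu | hu
  · rw [h.zero u hu]; simp
  · rw [abs_of_nonneg hu, Complex.coe_smul]

/-! ### Characters of the algebra. -/

/-- The characters of the convolution algebra: the Laplace transforms at points of the closed right
half-plane, and those vanishing on all tempered kernels. -/
theorem character_cases (χ : WeakDual.characterSpace ℂ ConvAlgebra) :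
    (∀ (β : ℝ) (hβ : 0 < β), χ (convElt (integrableKernel_temperedKernel hβ)) = 0) ∨
    ∃ s : ℂ, 0 ≤ s.re ∧ (∀ u, 0 ≤ u → χ (shiftElt u) = Complex.exp (-(s * u))) ∧
      ∀ (a : ℝ → ℝ) (h : IntegrableKernel a),
        χ (convElt h) = ∫ u : ℝ, (a u : ℂ) * Complex.exp (-(s * u)) := by
  by_cases hr : χ resolventElt = 0
  · left
    intro β hβ
    have hmul : ∀ {a b c : ℝ} (ha : 0 < a) (hb : 0 < b) (hc : 0 < c), a + b = c →
        convElt (integrableKernel_temperedKernel ha) *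
          convElt (integrableKernel_temperedKernel hb) =
          convElt (integrableKernel_temperedKernel hc) := by
      rintro a b _ ha hb hc rfl
      exact ConvAlgebra.toOp_injective (convOp_temperedKernel_mul ha hb hc)
    have hpow : ∀ (n : ℕ) (hn : 0 < (n + 1 : ℝ) * β),
        χ (convElt (integrableKernel_temperedKernel hn)) =
          χ (convElt (integrableKernel_temperedKernel hβ)) ^ (n + 1) := by
      intro n
      induction n with
      | zero =>
        intro hn
        simp
      | succ k ih =>
        intro hn
        have hk : 0 < (k + 1 : ℝ) * β := by positivity
        rw [pow_succ, ← ih hk, ← map_mul, hmul hk hβ hn (by push_cast; ring)]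
    -- A large power of the kernel of order β has order above 1, so it contains the resolvent as a
    -- factor and is killed by χ.
    obtain ⟨n, hn⟩ := exists_nat_gt (1 / β)
    have hn1 : 1 < (n + 1 : ℝ) * β := by
      have := (div_lt_iff₀ hβ).1 hn
      linarith
    have h1 := hpow n (by linarith)
    rw [← hmul (show 0 < (n + 1 : ℝ) * β - 1 by linarith) one_pos (by linarith) (by ring),
      map_mul, show convElt (integrableKernel_temperedKernel one_pos) = resolventElt from rfl, hr,
      mul_zero] at h1
    exact pow_eq_zero_iff (Nat.succ_ne_zero n) |>.1 h1.symm
  · right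
    -- Applying χ to the Bochner integral and cancelling χ of the resolvent shows that χ is
    -- determined on convolutions by its values on shifts, which form a bounded continuous
    -- multiplicative function.
    have hlap : ∀ (a : ℝ → ℝ) (h : IntegrableKernel a),
        χ (convElt h) = ∫ u : ℝ, (a u : ℂ) * χ (shiftElt u) := by
      intro a h
      have h1 := (WeakDual.CharacterSpace.toCLM χ).integral_comp_comm
        (integrable_smul_shiftElt_mul_resolventElt h)
      rw [← convElt_mul_resolventElt h] at h1
      have h2 : χ (convElt h) * χ resolventElt =
          ∫ u : ℝ, (a u : ℂ) * χ (shiftElt u) * χ resolventElt := by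
        rw [← map_mul]
        refine h1.symm.trans (integral_congr_ae (Eventually.of_forall fun u => ?_))
        change χ ((a u : ℂ) • (shiftElt u * resolventElt)) = _
        rw [map_smul, map_mul, smul_eq_mul]
        exact (mul_assoc _ _ _).symm
      rw [integral_mul_const] at h2
      exact mul_right_cancel₀ hr h2
    have hcont : Continuous fun u => χ (shiftElt u) := by
      have h1 : Continuous fun u => χ (shiftElt u * resolventElt) :=
        (WeakDual.CharacterSpace.toCLM χ).continuous.comp continuous_shiftElt_mul_resolventElt
      have h2 : (fun u => χ (shiftElt u)) =
          fun u => χ (shiftElt u * resolventElt) * (χ resolventElt)⁻¹ := by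
        funext u
        rw [map_mul, mul_assoc, mul_inv_cancel₀ hr, mul_one]
      rw [h2]
      exact h1.mul_const _
    have hm : ∀ u v, 0 ≤ u → 0 ≤ v → χ (shiftElt (u + v)) = χ (shiftElt u) * χ (shiftElt v) := by
      intro u v hu hv
      rw [← map_mul]
      exact congrArg χ (ConvAlgebra.toOp_injective (shiftOp_add hu hv))
    have hb : ∀ u, ‖χ (shiftElt u)‖ ≤ ‖WeakDual.CharacterSpace.toCLM χ‖ * 1 := fun u =>
      ((WeakDual.CharacterSpace.toCLM χ).le_opNorm _).trans
        (mul_le_mul_of_nonneg_left (norm_shiftElt_le u) (norm_nonneg _))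
    have hint : ∫ u in Ioi (0 : ℝ), Complex.exp (-u) * χ (shiftElt u) = χ resolventElt := by
      rw [resolventElt, hlap, ← integral_indicator measurableSet_Ioi]
      refine integral_congr_ae (Eventually.of_forall fun u => ?_)
      rcases le_or_gt u 0 with hu | hu
      · simp only [temperedKernel_of_nonpos hu]
        rw [indicator_of_notMem (by simpa using hu)]
        simp
      · simp only [temperedKernel_one hu]
        rw [indicator_of_mem (mem_Ioi.2 hu)]
        push_cast
        rfl
    obtain ⟨s, hs, hsu⟩ := exists_eq_exp_of_mul hcont hm hb (by rw [hint]; exact hr)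
    refine ⟨s, hs, hsu, fun a h => ?_⟩
    rw [hlap a h]
    refine integral_congr_ae (Eventually.of_forall fun u => ?_)
    simp only
    rcases lt_or_ge u 0 with hu | hu
    · rw [h.zero u hu]; simp
    · rw [hsu u hu]

/-! ### Matrices over the algebra. -/

section MatrixAction

variable {ι : Type*} [Fintype ι]

/-- The action of matrices over the convolution algebra on vectors of functions. -/
noncomputable def matrixAction (B : Matrix ι ι ConvAlgebra) :
    (ι → DecaySpace) →ₗ[ℂ] (ι → DecaySpace) where
  toFun z i := ∑ j, ConvAlgebra.toOp (B i j) (z j)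
  map_add' z w := by
    funext i
    simp [Finset.sum_add_distrib]
  map_smul' c z := by
    funext i
    simp [Finset.smul_sum]

theorem matrixAction_apply (B : Matrix ι ι ConvAlgebra) (z : ι → DecaySpace) (i : ι) :
    matrixAction B z i = ∑ j, ConvAlgebra.toOp (B i j) (z j) := rfl

theorem matrixAction_mul (B C : Matrix ι ι ConvAlgebra) (z : ι → DecaySpace) :
    matrixAction (B * C) z = matrixAction B (matrixAction C z) := by
  funext i
  simp only [matrixAction_apply, Matrix.mul_apply, map_sum, ConvAlgebra.toOp_mul,
    sum_apply, mul_apply_eq_comp]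
  exact Finset.sum_comm

theorem matrixAction_one [DecidableEq ι] (z : ι → DecaySpace) :
    matrixAction (1 : Matrix ι ι ConvAlgebra) z = z := by
  funext i
  rw [matrixAction_apply, Finset.sum_eq_single i]
  · simp [ConvAlgebra.toOp_one]
  · intro j _ hj
    simp [Matrix.one_apply_ne hj.symm]
  · simp

theorem exists_norm_matrixAction_le (B : Matrix ι ι ConvAlgebra) :
    ∃ K, 0 ≤ K ∧ ∀ z, ‖matrixAction B z‖ ≤ K * ‖z‖ := by
  have hnn : ∀ i, 0 ≤ ∑ j, ‖ConvAlgebra.toOp (B i j)‖ :=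
    fun i => Finset.sum_nonneg fun _ _ => norm_nonneg _
  refine ⟨∑ i, ∑ j, ‖ConvAlgebra.toOp (B i j)‖, Finset.sum_nonneg fun i _ => hnn i, fun z => ?_⟩
  refine (pi_norm_le_iff_of_nonneg (mul_nonneg (Finset.sum_nonneg fun i _ => hnn i)
    (norm_nonneg _))).2 fun i => ?_
  calc ‖matrixAction B z i‖ ≤ ∑ j, ‖ConvAlgebra.toOp (B i j) (z j)‖ := norm_sum_le _ _
    _ ≤ ∑ j, ‖ConvAlgebra.toOp (B i j)‖ * ‖z‖ := Finset.sum_le_sum fun j _ =>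
      ((ConvAlgebra.toOp (B i j)).le_opNorm _).trans
        (mul_le_mul_of_nonneg_left (norm_le_pi_norm z j) (norm_nonneg _))
    _ = (∑ j, ‖ConvAlgebra.toOp (B i j)‖) * ‖z‖ := (Finset.sum_mul _ _ _).symm
    _ ≤ _ := mul_le_mul_of_nonneg_right
      (Finset.single_le_sum (f := fun i => ∑ j, ‖ConvAlgebra.toOp (B i j)‖) (fun i _ => hnn i)
        (Finset.mem_univ i)) (norm_nonneg _)

end MatrixAction

/-! ### Inversion of the delay operator and the linear solver. -/

section DelayMatrix

variable {d : ℕ} {α : ℝ}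

/-- The matrix `1 - Q (N + A S_τ)` over the convolution algebra, with `Q` and `N` the convolutions
with the tempered kernel and the correction kernel of order `α`. -/
noncomputable def delayMatrix (hα0 : 0 < α) (hα1 : α < 1) (τ : ℝ) (A : Matrix (Fin d) (Fin d) ℝ) :
    Matrix (Fin d) (Fin d) ConvAlgebra :=
  1 - convElt (integrableKernel_temperedKernel hα0) •
    (convElt (integrableKernel_correctionKernel hα0 hα1) • (1 : Matrix (Fin d) (Fin d) ConvAlgebra) +
      shiftElt τ • A.map fun a => algebraMap ℂ ConvAlgebra a)

theorem map_delayMatrix (hα0 : 0 < α) (hα1 : α < 1) (τ : ℝ) (A : Matrix (Fin d) (Fin d) ℝ)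
    (f : ConvAlgebra →ₐ[ℂ] ℂ) :
    f.mapMatrix (delayMatrix hα0 hα1 τ A) =
      1 - f (convElt (integrableKernel_temperedKernel hα0)) •
        (f (convElt (integrableKernel_correctionKernel hα0 hα1)) • (1 : Matrix (Fin d) (Fin d) ℂ) +
          f (shiftElt τ) • A.map fun a : ℝ => (a : ℂ)) := by
  ext i j
  simp only [delayMatrix, AlgHom.mapMatrix_apply, Matrix.map_apply, Matrix.sub_apply,
    Matrix.add_apply, Matrix.smul_apply, smul_eq_mul, map_sub, map_add, map_mul,
    AlgHom.commutes]
  by_cases hij : i = j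
  · subst hij; simp
  · simp [Matrix.one_apply_ne hij]

/-- Otherwise the determinant is a non-unit of a commutative Banach algebra, so some character
annihilates it. A character killing tempered kernels sends it to 1. A Laplace character at s turns
the matrix into (1 + s)^{-α} e^{-sτ} (c - A) with c = s^α e^{sτ}, and c is not an eigenvalue. -/
theorem isUnit_delayMatrix (hα0 : 0 < α) (hα1 : α < 1) {τ : ℝ} (hτ : 0 < τ)
    (A : Matrix (Fin d) (Fin d) ℝ)
    (hA : spectrum ℂ (A.map (fun a : ℝ => (a : ℂ))) ⊆ stabilityRegion α τ) :
    IsUnit (delayMatrix hα0 hα1 τ A) := by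
  rw [Matrix.isUnit_iff_isUnit_det]
  by_contra hdet
  obtain ⟨χ, hχ⟩ := WeakDual.CharacterSpace.exists_apply_eq_zero hdet
  have hχ' : (WeakDual.CharacterSpace.toAlgHom χ) (delayMatrix hα0 hα1 τ A).det = 0 := hχ
  rw [AlgHom.map_det, map_delayMatrix] at hχ'
  change (1 - χ (convElt (integrableKernel_temperedKernel hα0)) •
    (χ (convElt (integrableKernel_correctionKernel hα0 hα1)) • (1 : Matrix (Fin d) (Fin d) ℂ) +
      χ (shiftElt τ) • A.map fun a : ℝ => (a : ℂ))).det = 0 at hχ'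
  rcases character_cases χ with h0 | ⟨s, hs, hshift, hconv⟩
  · rw [h0 α hα0, zero_smul, sub_zero, Matrix.det_one] at hχ'
    exact one_ne_zero hχ'
  · rw [hconv, hconv, hshift τ hτ.le, integral_temperedKernel_mul_cexp hα0 hs,
      integral_correctionKernel_mul_cexp hα0 hα1 hs] at hχ'
    have h1s : (1 : ℂ) + s ≠ 0 := by
      intro h
      have := congrArg Complex.re h
      simp at this
      linarith
    set c := s ^ (α : ℂ) * Complex.exp (s * τ) with hc
    have hcs : c ∉ spectrum ℂ (A.map (fun a : ℝ => (a : ℂ))) :=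
      fun h => cpow_mul_exp_notMem_stabilityRegion hα0 hτ hs (hA h)
    rw [spectrum.notMem_iff] at hcs
    have hinv : (1 + s) ^ (-(α : ℂ)) * (1 + s) ^ (α : ℂ) = 1 := by
      rw [← Complex.cpow_add _ _ h1s]; simp
    have hexp : Complex.exp (-(s * τ)) * Complex.exp (s * τ) = 1 := by
      rw [← Complex.exp_add]; simp
    have hfac : (1 : Matrix (Fin d) (Fin d) ℂ) - (1 + s) ^ (-(α : ℂ)) •
        (((1 + s) ^ (α : ℂ) - s ^ (α : ℂ)) • (1 : Matrix (Fin d) (Fin d) ℂ) +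
          Complex.exp (-(s * τ)) • A.map fun a : ℝ => (a : ℂ)) =
        ((1 + s) ^ (-(α : ℂ)) * Complex.exp (-(s * τ))) •
          (algebraMap ℂ (Matrix (Fin d) (Fin d) ℂ) c - A.map fun a : ℝ => (a : ℂ)) := by
      ext i j
      simp only [Matrix.sub_apply, Matrix.smul_apply, Matrix.add_apply, smul_eq_mul,
        Matrix.algebraMap_matrix_apply, Algebra.algebraMap_self, RingHom.id_apply, hc]
      by_cases hij : i = j
      · subst hij
        simp only [Matrix.one_apply_eq, if_true]
        linear_combination (-1 : ℂ) * hinv - (1 + s) ^ (-(α : ℂ)) * s ^ (α : ℂ) * hexp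
      · simp only [Matrix.one_apply_ne hij, if_neg hij]
        ring
    rw [hfac, Matrix.det_smul] at hχ'
    rcases mul_eq_zero.1 hχ' with h | h
    · refine (mul_ne_zero ?_ (Complex.exp_ne_zero _)) (eq_zero_of_pow_eq_zero h)
      exact left_ne_zero_of_mul_eq_one hinv
    · exact ((Matrix.isUnit_iff_isUnit_det _).1 hcs).ne_zero h

theorem matrixAction_delayMatrix_apply (hα0 : 0 < α) (hα1 : α < 1) {τ : ℝ} (hτ : 0 < τ)
    (A : Matrix (Fin d) (Fin d) ℝ) (z : Fin d → DecaySpace) (i : Fin d) (t : ℝ) :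
    matrixAction (delayMatrix hα0 hα1 τ A) z i t =
      z i t - conv (temperedKernel α)
        (fun t => conv (correctionKernel α) (z i) t + ∑ j, (A i j : ℂ) * z j (t - τ)) t := by
  set Q := convElt (integrableKernel_temperedKernel hα0)
  set N := convElt (integrableKernel_correctionKernel hα0 hα1)
  have hM : matrixAction (delayMatrix hα0 hα1 τ A) z i =
      z i - ConvAlgebra.toOp Q (ConvAlgebra.toOp N (z i) +
        ∑ j, (A i j : ℂ) • ConvAlgebra.toOp (shiftElt τ) (z j)) := by
    have hentry : ∀ j, ConvAlgebra.toOp (delayMatrix hα0 hα1 τ A i j) (z j) =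
        ConvAlgebra.toOp ((1 : Matrix (Fin d) (Fin d) ConvAlgebra) i j) (z j) -
        ConvAlgebra.toOp Q (ConvAlgebra.toOp N
          (ConvAlgebra.toOp ((1 : Matrix (Fin d) (Fin d) ConvAlgebra) i j) (z j)) +
          (A i j : ℂ) • ConvAlgebra.toOp (shiftElt τ) (z j)) := by
      intro j
      have : delayMatrix hα0 hα1 τ A i j = (1 : Matrix (Fin d) (Fin d) ConvAlgebra) i j -
          Q * (N * (1 : Matrix (Fin d) (Fin d) ConvAlgebra) i j + (A i j : ℂ) • shiftElt τ) := by
        simp only [delayMatrix, Matrix.sub_apply, Matrix.smul_apply, Matrix.add_apply, smul_eq_mul,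
          Matrix.map_apply]
        rw [Algebra.smul_def, mul_comm (shiftElt τ)]
      rw [this, map_sub, ConvAlgebra.toOp_mul, map_add, ConvAlgebra.toOp_mul, map_smul]
      rfl
    have hone := congrFun (matrixAction_one z) i
    rw [matrixAction_apply] at hone
    rw [matrixAction_apply]
    simp only [hentry]
    rw [Finset.sum_sub_distrib, ← map_sum, Finset.sum_add_distrib, ← map_sum, hone]
  rw [hM]
  change z i t - conv (temperedKernel α) (ConvAlgebra.toOp N (z i) +
        ∑ j, (A i j : ℂ) • ConvAlgebra.toOp (shiftElt τ) (z j) : DecaySpace) t = _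
  congr 2
  funext t
  have h := (DecaySpace.evalCLM t).map_add (ConvAlgebra.toOp N (z i))
    (∑ j, (A i j : ℂ) • ConvAlgebra.toOp (shiftElt τ) (z j))
  rw [map_sum] at h
  refine h.trans ?_
  congr 1
  refine Finset.sum_congr rfl fun j _ => ?_
  rw [map_smul, smul_eq_mul]
  change (A i j : ℂ) * z j (t - |τ|) = _
  rw [abs_of_pos hτ]

theorem re_conv {a : ℝ → ℝ} (ha : CausalInt a) {w : ℝ → ℂ} (hw : CausalCont w) (t : ℝ) :
    (conv a w t).re = conv a (fun t => (w t).re) t := by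
  have h := Complex.reCLM.integral_comp_comm (integrable_conv ha hw t)
  simpa [conv] using h.symm

theorem CausalCont.re {w : ℝ → ℂ} (hw : CausalCont w) : CausalCont fun t => (w t).re :=
  ⟨fun t ht => by simp [hw.zero t ht], Complex.continuous_re.comp_continuousOn hw.cont⟩

theorem CausalCont.const_mul {w : ℝ → ℝ} (hw : CausalCont w) (c : ℝ) :
    CausalCont fun t => c * w t :=
  ⟨fun t ht => by simp [hw.zero t ht], hw.cont.const_smul c⟩

theorem CausalCont.sum {ι E : Type*} [NormedAddCommGroup E] (s : Finset ι) {w : ι → ℝ → E}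
    (hw : ∀ i ∈ s, CausalCont (w i)) : CausalCont fun t => ∑ i ∈ s, w i t :=
  ⟨fun t ht => Finset.sum_eq_zero fun i hi => (hw i hi).zero t ht,
    continuousOn_finsetSum s fun i hi => (hw i hi).cont⟩

theorem DecaySpace.causalCont_re (f : DecaySpace) : CausalCont fun t => (f t).re :=
  f.causalCont.re

theorem DecaySpace.causalCont_re_shift (f : DecaySpace) {τ : ℝ} (hτ : 0 ≤ τ) :
    CausalCont fun t => (f (t - τ)).re :=
  .of_continuous (Complex.continuous_re.comp (f.continuous.comp (by fun_prop)))
    fun t ht => by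
      have : f (t - τ) = 0 := f.2.1 _ (by linarith)
      rw [this, Complex.zero_re]

/-- The solution operator of the linear inhomogeneous delay equation: it is bounded, and maps
`I^α`-regularised right-hand sides to solutions of the integrated equation. -/
theorem exists_linear_solver (hα0 : 0 < α) (hα1 : α < 1) {τ : ℝ} (hτ : 0 < τ)
    (A : Matrix (Fin d) (Fin d) ℝ)
    (hA : spectrum ℂ (A.map (fun a : ℝ => (a : ℂ))) ⊆ stabilityRegion α τ) :
    ∃ (K : ℝ) (G : (Fin d → DecaySpace) →ₗ[ℂ] (Fin d → DecaySpace)), 0 ≤ K ∧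
      (∀ b, ‖G b‖ ≤ K * ‖b‖) ∧
      ∀ (h : Fin d → ℝ → ℝ) (b : Fin d → DecaySpace), (∀ i, CausalCont (h i)) →
        (∀ i t, (b i t).re = conv (temperedKernel α) (h i) t) → ∀ i t,
        conv (rlKernel (1 - α)) (fun t => (G b i t).re) t =
          conv heaviside (fun t => ∑ j, A i j * (G b j (t - τ)).re + h i t) t := by
  -- The inverse B has entries in the algebra, so it acts boundedly on decaying functions.
  obtain ⟨⟨M, B, hMB, -⟩, rfl : M = delayMatrix hα0 hα1 τ A⟩ := isUnit_delayMatrix hα0 hα1 hτ A hA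
  obtain ⟨K, hK0, hK⟩ := exists_norm_matrixAction_le B
  refine ⟨K, matrixAction B, hK0, hK, fun h b hh hb i t => ?_⟩
  set z := matrixAction B b with hz
  have hMz : matrixAction (delayMatrix hα0 hα1 τ A) z = b := by
    rw [hz, ← matrixAction_mul, hMB, matrixAction_one]
  have hq := causalInt_temperedKernel hα0
  have hn := causalInt_correctionKernel hα0 hα1
  have hH := causalInt_heaviside
  set x : Fin d → ℝ → ℝ := fun i t => (z i t).re with hx
  have hxc : ∀ i, CausalCont (x i) := fun i => (z i).causalCont_re
  set v : ℝ → ℝ := fun t => ∑ j, A i j * (z j (t - τ)).re + h i t with hv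
  have hvs : CausalCont fun t => ∑ j, A i j * (z j (t - τ)).re :=
    .sum _ fun j _ => ((z j).causalCont_re_shift hτ.le).const_mul (A i j)
  have hvc : CausalCont v := hvs.add (hh i)
  have hnx : CausalCont (conv (correctionKernel α) (x i)) := CausalCont.conv hn (hxc i)
  -- This is the real part of M z = b; complex scalars serve only Gelfand theory. Convolving x = q *
  -- (n * x + v) with k_{1-α} then cancels the n * x terms and leaves I^{1-α} x = I v.
  have hfix : x i = conv (temperedKernel α) (fun t => conv (correctionKernel α) (x i) t + v t) := by
    funext t
    have h1 := matrixAction_delayMatrix_apply hα0 hα1 hτ A z i t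
    rw [hMz] at h1
    have h2 := congrArg Complex.re h1
    have hc1 : CausalCont fun t => conv (correctionKernel α) (z i) t :=
      CausalCont.conv hn (z i).causalCont
    have hc2 : CausalCont fun t => ∑ j, (A i j : ℂ) * z j (t - τ) := by
      refine .of_continuous (continuous_finsetSum _ fun j _ => continuous_const.mul
        ((z j).continuous.comp (by fun_prop))) fun t ht => Finset.sum_eq_zero fun j _ => ?_
      rw [(z j).2.1 _ (by linarith), mul_zero]
    rw [Complex.sub_re, hb, re_conv hq (hc1.add hc2)] at h2
    have h3 : (fun t => (conv (correctionKernel α) (z i) t +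
        ∑ j, (A i j : ℂ) * z j (t - τ)).re) =
        fun t => conv (correctionKernel α) (x i) t + ∑ j, A i j * (z j (t - τ)).re := by
      funext t
      rw [Complex.add_re, re_conv hn (z i).causalCont, Complex.re_sum]
      simp [hx]
    rw [h3] at h2
    have h4 : (fun t => conv (correctionKernel α) (x i) t + v t) = fun t =>
        (conv (correctionKernel α) (x i) t + ∑ j, A i j * (z j (t - τ)).re) + h i t := by
      funext t; simp only [hv]; ring
    rw [h4, conv_add_right hq (hnx.add hvs) (hh i), h2, hx]
    ring
  have key := conv_rlKernel_conv_temperedKernel hα0 hα1 (hnx.add hvc) t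
  rw [← hfix, conv_add_right hH hnx hvc] at key
  linarith

end DelayMatrix

/-! ### The ramp function and its Caputo derivative. -/

section Ramp

theorem CausalCont.exists_bound {E : Type*} [NormedAddCommGroup E] {w : ℝ → E} (hw : CausalCont w)
    (hl : Tendsto w atTop (𝓝 0)) : ∃ C, 0 ≤ C ∧ ∀ t, ‖w t‖ ≤ C := by
  obtain ⟨T, hT⟩ := eventually_atTop.1 (hl.norm.eventually (gt_mem_nhds (show ‖(0 : E)‖ < 1 by simp)))
  obtain ⟨C, hC0, hC⟩ := hw.bound T
  refine ⟨max C 1, hC0.trans (le_max_left _ _), fun t => ?_⟩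
  rcases le_total t T with h | h
  · exact (hC t h).trans (le_max_left _ _)
  · exact (hT t h).le.trans (le_max_right _ _)

theorem conv_shift {E : Type*} [NormedAddCommGroup E] [NormedSpace ℝ E] (a : ℝ → ℝ) (w : ℝ → E)
    (c t : ℝ) : conv a (fun t => w (t - c)) t = conv a w (t - c) := by
  simp only [conv, sub_right_comm]

theorem heaviside_ae_eq_rlKernel_one : heaviside =ᵐ[volume] rlKernel 1 := by
  have h0 : ∀ᵐ t : ℝ, t ≠ 0 := by simp [ae_iff]
  filter_upwards [h0] with t ht
  rcases lt_or_gt_of_ne ht with ht | ht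
  · rw [rlKernel_of_nonpos ht.le, causalInt_heaviside.zero t ht]
  · rw [rlKernel_of_pos ht]
    simp [heaviside, ht.le]

theorem conv_rlKernel_heaviside {β : ℝ} (hβ : 0 < β) :
    conv (rlKernel β) heaviside = rlKernel (1 + β) := by
  rw [conv_comm, conv_congr_ae heaviside_ae_eq_rlKernel_one, conv_rlKernel one_pos hβ]

theorem continuous_rlKernel {β : ℝ} (hβ : 0 < β) : Continuous (rlKernel (1 + β)) := by
  rw [← conv_rlKernel_heaviside hβ]
  exact continuous_conv (causalInt_rlKernel hβ) causalCont_one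

theorem causalCont_rlKernel {β : ℝ} (hβ : 0 < β) : CausalCont (rlKernel (1 + β)) :=
  .of_continuous (continuous_rlKernel hβ) fun _ ht => rlKernel_of_nonpos ht.le

/-- The kernel `k_{1+β}(t) - k_{1+β}(t - 1)`. -/
noncomputable def rlKernelDiff (β t : ℝ) : ℝ := rlKernel (1 + β) t - rlKernel (1 + β) (t - 1)

theorem continuous_rlKernelDiff {β : ℝ} (hβ : 0 < β) : Continuous (rlKernelDiff β) :=
  (continuous_rlKernel hβ).sub ((continuous_rlKernel hβ).comp (by fun_prop))

theorem rlKernelDiff_of_nonpos {β t : ℝ} (ht : t ≤ 0) : rlKernelDiff β t = 0 := by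
  rw [rlKernelDiff, rlKernel_of_nonpos ht, rlKernel_of_nonpos (by linarith), sub_zero]

theorem causalCont_rlKernelDiff {β : ℝ} (hβ : 0 < β) : CausalCont (rlKernelDiff β) :=
  .of_continuous (continuous_rlKernelDiff hβ) fun _ ht => rlKernelDiff_of_nonpos ht.le

theorem rlKernelDiff_one_of_one_le {t : ℝ} (ht : 1 ≤ t) : rlKernelDiff 1 t = 1 := by
  have h1 : ∀ s : ℝ, 0 ≤ s → rlKernel (1 + 1) s = s := by
    intro s hs
    rcases hs.eq_or_lt with rfl | hs
    · exact rlKernel_of_nonpos le_rfl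
    · rw [rlKernel_of_pos hs, Real.Gamma_add_one one_ne_zero, Real.Gamma_one]; simp
  rw [rlKernelDiff, h1 t (by linarith), h1 (t - 1) (by linarith)]
  ring

theorem rlKernelDiff_one_mem (t : ℝ) : rlKernelDiff 1 t ∈ Icc (0 : ℝ) 1 := by
  rcases le_total 1 t with h | h
  · rw [rlKernelDiff_one_of_one_le h]; simp
  · rcases le_or_gt t 0 with h0 | h0
    · rw [rlKernelDiff_of_nonpos h0]; simp
    · rw [rlKernelDiff, rlKernel_of_nonpos (show t - 1 ≤ 0 by linarith), rlKernel_of_pos h0,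
        Real.Gamma_add_one one_ne_zero, Real.Gamma_one]
      simp [h, h0.le]

/-- With β = 1 - α, this identifies the Caputo derivative of the ramp min(t, 1): both sides are
differences of k_{2+β} and its shift by 1. -/
theorem conv_rlKernel_rlKernelDiff {β : ℝ} (hβ : 0 < β) (t : ℝ) :
    conv (rlKernel β) (rlKernelDiff 1) t = conv heaviside (rlKernelDiff β) t := by
  have hk := causalInt_rlKernel hβ
  have hH := causalInt_heaviside
  have h1 : ∀ t, conv (rlKernel β) (rlKernel (1 + 1)) t = conv heaviside (rlKernel (1 + β)) t := by
    intro t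
    rw [← conv_rlKernel_heaviside one_pos, ← conv_rlKernel_heaviside hβ,
      ← conv_congr_ae heaviside_ae_eq_rlKernel_one, conv_left_comm hk hH causalCont_one]
  have hs : ∀ {γ : ℝ}, 0 < γ → CausalCont fun t => rlKernel (1 + γ) (t - 1) := fun hγ =>
    .of_continuous ((continuous_rlKernel hγ).comp (by fun_prop))
      fun t ht => rlKernel_of_nonpos (by linarith)
  unfold rlKernelDiff
  rw [conv_sub_right hk (causalCont_rlKernel one_pos) (hs one_pos),
    conv_sub_right hH (causalCont_rlKernel hβ) (hs hβ), conv_shift _ (rlKernel (1 + 1)),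
    conv_shift _ (rlKernel (1 + β)), h1, h1]

/-- Since (1 - 1/t)^β ≥ 1 - 1/t, the increment t^β - (t - 1)^β is at most t^{β-1}. -/
theorem tendsto_rlKernelDiff {β : ℝ} (hβ0 : 0 < β) (hβ1 : β < 1) :
    Tendsto (rlKernelDiff β) atTop (𝓝 0) := by
  have hlim : Tendsto (fun t : ℝ => t ^ (-(1 - β)) / Real.Gamma (1 + β)) atTop (𝓝 0) := by
    simpa using (tendsto_rpow_neg_atTop (show 0 < 1 - β by linarith)).div_const
      (Real.Gamma (1 + β))
  have hG : 0 < Real.Gamma (1 + β) := Real.Gamma_pos_of_pos (by linarith)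
  refine squeeze_zero' ?_ ?_ hlim
  all_goals
    filter_upwards [eventually_gt_atTop 1] with t ht
    have ht0 : 0 < t := by linarith
    have ht1 : 0 < t - 1 := by linarith
    rw [rlKernelDiff, rlKernel_of_pos ht0, rlKernel_of_pos ht1, add_sub_cancel_left]
  · rw [sub_nonneg]
    gcongr
    linarith
  · rw [← sub_div]
    gcongr
    have h1 : (t - 1) ^ β = t ^ β * (1 - 1 / t) ^ β := by
      rw [← Real.mul_rpow ht0.le (by rw [sub_nonneg, div_le_one ht0]; exact ht.le)]
      congr 1
      field_simp
    have h2 : 1 - 1 / t ≤ (1 - 1 / t) ^ β := by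
      refine Real.self_le_rpow_of_le_one ?_ ?_ hβ1.le
      · rw [sub_nonneg, div_le_one ht0]; exact ht.le
      · have : 0 < 1 / t := by positivity
        linarith
    have h3 : t ^ (-(1 - β)) = t ^ β * (1 / t) := by
      rw [show -(1 - β) = β - 1 by ring, Real.rpow_sub_one ht0.ne']
      ring
    have h4 : 0 ≤ t ^ β := by positivity
    rw [h1, h3]
    nlinarith

end Ramp

/-! ### Truncation of the nonlinearity to a cube. -/

section Clamp

variable {d : ℕ}

/-- The coordinatewise projection on the cube `[-ρ, ρ]^d`. -/
def clamp (ρ : ℝ) (v : Fin d → ℝ) : Fin d → ℝ := fun i => max (-ρ) (min ρ (v i))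

theorem norm_clamp_le {ρ : ℝ} (hρ : 0 ≤ ρ) (v : Fin d → ℝ) : ‖clamp ρ v‖ ≤ ρ := by
  refine (pi_norm_le_iff_of_nonneg hρ).2 fun i => ?_
  rw [Real.norm_eq_abs, abs_le]
  exact ⟨le_max_left _ _, max_le (by linarith) (min_le_left _ _)⟩

theorem norm_clamp_sub_le (ρ : ℝ) (v w : Fin d → ℝ) : ‖clamp ρ v - clamp ρ w‖ ≤ ‖v - w‖ := by
  refine (pi_norm_le_iff_of_nonneg (norm_nonneg _)).2 fun i => ?_
  refine le_trans ?_ (norm_le_pi_norm (v - w) i)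
  simp only [Pi.sub_apply, clamp, Real.norm_eq_abs]
  have h1 := abs_max_sub_max_le_abs (min ρ (v i)) (min ρ (w i)) (-ρ)
  have h2 := abs_min_sub_min_le_max ρ (v i) ρ (w i)
  rw [max_comm (-ρ), max_comm (-ρ)]
  refine h1.trans (h2.trans ?_)
  simp

theorem clamp_of_norm_le {ρ : ℝ} {v : Fin d → ℝ} (hv : ‖v‖ ≤ ρ) : clamp ρ v = v := by
  funext i
  have h := (norm_le_pi_norm v i).trans hv
  rw [Real.norm_eq_abs, abs_le] at h
  simp only [clamp]
  rw [min_eq_right h.2, max_eq_right h.1]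

/-- `g` is Lipschitz with constant `κ` on the cube of radius `ρ`. -/
def LipOnCube (g : (Fin d → ℝ) → (Fin d → ℝ) → (Fin d → ℝ)) (κ ρ : ℝ) : Prop :=
  ∀ x y x' y', ‖x‖ ≤ ρ → ‖y‖ ≤ ρ → ‖x'‖ ≤ ρ → ‖y'‖ ≤ ρ →
    ‖g x y - g x' y'‖ ≤ κ * (‖x - x'‖ + ‖y - y'‖)

theorem LipOnCube.clamp {g : (Fin d → ℝ) → (Fin d → ℝ) → (Fin d → ℝ)} {κ ρ : ℝ} (hκ : 0 ≤ κ)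
    (hρ : 0 ≤ ρ) (hg : LipOnCube g κ ρ) (x y x' y' : Fin d → ℝ) :
    ‖g (clamp ρ x) (clamp ρ y) - g (clamp ρ x') (clamp ρ y')‖ ≤ κ * (‖x - x'‖ + ‖y - y'‖) :=
  (hg _ _ _ _ (norm_clamp_le hρ _) (norm_clamp_le hρ _) (norm_clamp_le hρ _)
    (norm_clamp_le hρ _)).trans (mul_le_mul_of_nonneg_left
      (add_le_add (norm_clamp_sub_le _ _ _) (norm_clamp_sub_le _ _ _)) hκ)

theorem continuous_of_lipschitz_pair {g : (Fin d → ℝ) → (Fin d → ℝ) → (Fin d → ℝ)} {κ : ℝ}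
    (hκ : 0 ≤ κ) (hg : ∀ x y x' y', ‖g x y - g x' y'‖ ≤ κ * (‖x - x'‖ + ‖y - y'‖)) :
    Continuous fun z : (Fin d → ℝ) × (Fin d → ℝ) => g z.1 z.2 := by
  refine (LipschitzWith.of_dist_le_mul (K := ⟨κ * 2, by positivity⟩) fun z w => ?_).continuous
  rw [dist_eq_norm, dist_eq_norm]
  refine (hg _ _ _ _).trans ?_
  have h1 : ‖z.1 - w.1‖ ≤ ‖z - w‖ := norm_fst_le (z - w)
  have h2 : ‖z.2 - w.2‖ ≤ ‖z - w‖ := norm_snd_le (z - w)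
  calc κ * (‖z.1 - w.1‖ + ‖z.2 - w.2‖) ≤ κ * (‖z - w‖ + ‖z - w‖) := by gcongr
    _ = κ * 2 * ‖z - w‖ := by ring

end Clamp

/-! ### Convolution of forcing terms with a jump at the origin. -/

section Smoothing

/-- Convolution of an integrable kernel with a function that may jump at the origin. -/
noncomputable def smoothing {a : ℝ → ℝ} (h : IntegrableKernel a) {w : ℝ → ℂ} (hw : CausalCont w)
    (hl : Tendsto w atTop (𝓝 0)) : DecaySpace :=
  DecaySpace.ofFun (conv a w) (continuous_conv h.causalInt hw)
    (fun _ ht => conv_nonpos h.causalInt hw ht)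
    (tendsto_conv_atTop h.integrable hw (hw.exists_bound hl).choose_spec.2 hl) _
    (norm_conv_le h.integrable (hw.exists_bound hl).choose_spec.2)

theorem norm_smoothing_le {a : ℝ → ℝ} (h : IntegrableKernel a) {w : ℝ → ℂ} (hw : CausalCont w)
    (hl : Tendsto w atTop (𝓝 0)) {c : ℝ} (hc : 0 ≤ c) (hwc : ∀ t, ‖w t‖ ≤ c) :
    ‖smoothing h hw hl‖ ≤ (∫ u, ‖a u‖) * c :=
  DecaySpace.norm_le (mul_nonneg (integral_nonneg fun _ => norm_nonneg _) hc)
    (norm_conv_le h.integrable hwc)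

theorem norm_smoothing_sub_le {a : ℝ → ℝ} (h : IntegrableKernel a) {v w : ℝ → ℂ}
    (hv : CausalCont v) (hvl : Tendsto v atTop (𝓝 0)) (hw : CausalCont w)
    (hwl : Tendsto w atTop (𝓝 0)) {c : ℝ} (hc : 0 ≤ c) (hvw : ∀ t, ‖v t - w t‖ ≤ c) :
    ‖smoothing h hv hvl - smoothing h hw hwl‖ ≤ (∫ u, ‖a u‖) * c := by
  refine DecaySpace.norm_le (mul_nonneg (integral_nonneg fun _ => norm_nonneg _) hc) fun t => ?_
  change ‖conv a v t - conv a w t‖ ≤ _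
  rw [← conv_sub_right h.causalInt hv hw]
  exact norm_conv_le h.integrable hvw t

end Smoothing

/-! ### Existence of small decaying solutions. -/

section Existence

variable {d : ℕ}

/-- An extension of the initial function to the line which vanishes on `[1, ∞)` and whose Caputo
derivative is explicit. -/
noncomputable def historyExt (τ : ℝ) (φ : ℝ → Fin d → ℝ) (t : ℝ) : Fin d → ℝ :=
  (1 - rlKernelDiff 1 t) • φ (max (-τ) (min t 0))

theorem continuous_historyExt {τ : ℝ} (hτ : 0 < τ) {φ : ℝ → Fin d → ℝ}
    (hφ : ContinuousOn φ (Icc (-τ) 0)) : Continuous (historyExt τ φ) :=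
  (continuous_const.sub (continuous_rlKernelDiff one_pos)).smul
    (hφ.comp_continuous (by fun_prop)
      fun t => ⟨le_max_left _ _, max_le (by linarith) (min_le_right _ _)⟩)

theorem historyExt_of_mem {τ : ℝ} {φ : ℝ → Fin d → ℝ} {t : ℝ} (ht : t ∈ Icc (-τ) 0) :
    historyExt τ φ t = φ t := by
  rw [historyExt, rlKernelDiff_of_nonpos ht.2, sub_zero, one_smul, min_eq_left ht.2,
    max_eq_right ht.1]

theorem historyExt_of_nonneg {τ : ℝ} (hτ : 0 < τ) {φ : ℝ → Fin d → ℝ} {t : ℝ} (ht : 0 ≤ t) :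
    historyExt τ φ t = (1 - rlKernelDiff 1 t) • φ 0 := by
  rw [historyExt, min_eq_right ht, max_eq_right (by linarith)]

theorem norm_historyExt_le {τ : ℝ} (hτ : 0 < τ) {φ : ℝ → Fin d → ℝ} {δ : ℝ}
    (hδ : ∀ s ∈ Icc (-τ) 0, ‖φ s‖ ≤ δ) (t : ℝ) : ‖historyExt τ φ t‖ ≤ δ := by
  have h := rlKernelDiff_one_mem t
  rw [historyExt, norm_smul, Real.norm_of_nonneg (by linarith [h.2])]
  refine (mul_le_of_le_one_left (norm_nonneg _) (by linarith [h.1])).trans (hδ _ ?_)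
  exact ⟨le_max_left _ _, max_le (by linarith) (min_le_right _ _)⟩

theorem tendsto_historyExt (τ : ℝ) (φ : ℝ → Fin d → ℝ) :
    Tendsto (historyExt τ φ) atTop (𝓝 0) := by
  refine tendsto_const_nhds.congr' ?_
  filter_upwards [eventually_ge_atTop 1] with t ht
  rw [historyExt, rlKernelDiff_one_of_one_le ht, sub_self, zero_smul]

/-- The sum of a given function and the real part of a vector of elements of `DecaySpace`. -/
noncomputable def trajectory (ψ : ℝ → Fin d → ℝ) (z : Fin d → DecaySpace) (t : ℝ) : Fin d → ℝ :=
  fun i => ψ t i + (z i t).re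

theorem continuous_trajectory {ψ : ℝ → Fin d → ℝ} (hψ : Continuous ψ) (z : Fin d → DecaySpace) :
    Continuous (trajectory ψ z) :=
  continuous_pi fun i => ((continuous_apply i).comp hψ).add
    (Complex.continuous_re.comp (z i).continuous)

theorem tendsto_trajectory {ψ : ℝ → Fin d → ℝ} (hψ : Tendsto ψ atTop (𝓝 0))
    (z : Fin d → DecaySpace) : Tendsto (trajectory ψ z) atTop (𝓝 0) := by
  refine tendsto_pi_nhds.2 fun i => ?_
  have h := (tendsto_pi_nhds.1 hψ i).add
    ((Complex.continuous_re.tendsto 0).comp (z i).tendsto)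
  rw [Complex.zero_re, Pi.zero_apply, add_zero] at h
  exact h

theorem abs_re_apply_le (z : Fin d → DecaySpace) (i : Fin d) (t : ℝ) : |(z i t).re| ≤ ‖z‖ :=
  ((Complex.abs_re_le_norm _).trans ((z i).norm_apply_le t)).trans (norm_le_pi_norm z i)

theorem norm_trajectory_le (ψ : ℝ → Fin d → ℝ) (z : Fin d → DecaySpace) (t : ℝ) :
    ‖trajectory ψ z t‖ ≤ ‖ψ t‖ + ‖z‖ := by
  refine (pi_norm_le_iff_of_nonneg (by positivity)).2 fun i => ?_
  exact (norm_add_le _ _).trans (add_le_add (norm_le_pi_norm _ i) (abs_re_apply_le z i t))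

theorem norm_trajectory_sub_le (ψ : ℝ → Fin d → ℝ) (z z' : Fin d → DecaySpace) (t : ℝ) :
    ‖trajectory ψ z t - trajectory ψ z' t‖ ≤ ‖z - z'‖ := by
  refine (pi_norm_le_iff_of_nonneg (norm_nonneg _)).2 fun i => ?_
  have h : (trajectory ψ z t - trajectory ψ z' t) i = ((z - z') i t).re := by
    change ψ t i + (z i t).re - (ψ t i + (z' i t).re) = (z i t - z' i t).re
    rw [Complex.sub_re]; ring
  rw [h]
  exact abs_re_apply_le _ i t

/-- The right-hand side of the equation for the decaying part of the solution. -/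
noncomputable def forcing (α τ : ℝ) (A : Matrix (Fin d) (Fin d) ℝ)
    (g : (Fin d → ℝ) → (Fin d → ℝ) → (Fin d → ℝ)) (φ : ℝ → Fin d → ℝ)
    (z : Fin d → DecaySpace) (t : ℝ) : Fin d → ℝ :=
  A.mulVec (historyExt τ φ (t - τ)) +
    g (trajectory (historyExt τ φ) z t) (trajectory (historyExt τ φ) z (t - τ)) +
    rlKernelDiff (1 - α) t • φ 0

variable {α τ : ℝ} {A : Matrix (Fin d) (Fin d) ℝ} {g : (Fin d → ℝ) → (Fin d → ℝ) → (Fin d → ℝ)}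
  {φ : ℝ → Fin d → ℝ}

theorem continuous_forcing (hα1 : α < 1) (hτ : 0 < τ)
    (hg : Continuous fun z : (Fin d → ℝ) × (Fin d → ℝ) => g z.1 z.2)
    (hφ : ContinuousOn φ (Icc (-τ) 0)) (z : Fin d → DecaySpace) :
    Continuous (forcing α τ A g φ z) := by
  have hψ := continuous_historyExt hτ hφ
  have hx := continuous_trajectory hψ z
  have hs : Continuous fun t : ℝ => t - τ := by fun_prop
  exact ((Continuous.matrix_mulVec continuous_const (hψ.comp hs)).add
    (hg.comp (hx.prodMk (hx.comp hs)))).add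
    ((continuous_rlKernelDiff (by linarith)).smul continuous_const)

theorem tendsto_forcing (hα0 : 0 < α) (hα1 : α < 1)
    (hg : Continuous fun z : (Fin d → ℝ) × (Fin d → ℝ) => g z.1 z.2) (hg0 : g 0 0 = 0)
    (z : Fin d → DecaySpace) : Tendsto (forcing α τ A g φ z) atTop (𝓝 0) := by
  have hψ := tendsto_historyExt τ φ
  have hx := tendsto_trajectory hψ z
  have hs : Tendsto (fun t : ℝ => t - τ) atTop atTop :=
    tendsto_atTop_add_const_right atTop (-τ) tendsto_id
  have h1 : Tendsto (fun t => A.mulVec (historyExt τ φ (t - τ))) atTop (𝓝 0) := by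
    have hc : Continuous fun v : Fin d → ℝ => A.mulVec v :=
      Continuous.matrix_mulVec continuous_const continuous_id
    have := (hc.tendsto 0).comp (hψ.comp hs)
    rwa [Matrix.mulVec_zero] at this
  have h2 : Tendsto (fun t => g (trajectory (historyExt τ φ) z t)
      (trajectory (historyExt τ φ) z (t - τ))) atTop (𝓝 0) := by
    have := (hg.tendsto (0, 0)).comp (hx.prodMk_nhds (hx.comp hs))
    rwa [hg0] at this
  have h3 := (tendsto_rlKernelDiff (show 0 < 1 - α by linarith) (by linarith)).smul_const (φ 0)
  have h := (h1.add h2).add h3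
  rw [zero_smul, add_zero, add_zero] at h
  exact h

theorem norm_forcing_sub_le {κ : ℝ} (hκ : 0 ≤ κ)
    (hg : ∀ x y x' y', ‖g x y - g x' y'‖ ≤ κ * (‖x - x'‖ + ‖y - y'‖))
    (z z' : Fin d → DecaySpace) (t : ℝ) :
    ‖forcing α τ A g φ z t - forcing α τ A g φ z' t‖ ≤ 2 * κ * ‖z - z'‖ := by
  simp only [forcing, add_sub_add_right_eq_sub, add_sub_add_left_eq_sub]
  refine (hg _ _ _ _).trans ?_
  calc _ ≤ κ * (‖z - z'‖ + ‖z - z'‖) := by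
        gcongr <;> exact norm_trajectory_sub_le _ _ _ _
    _ = _ := by ring

theorem norm_forcing_zero_le (hτ : 0 < τ) {κ a Z δ : ℝ} (hκ : 0 ≤ κ)
    (hg : ∀ x y x' y', ‖g x y - g x' y'‖ ≤ κ * (‖x - x'‖ + ‖y - y'‖)) (hg0 : g 0 0 = 0)
    (ha0 : 0 ≤ a) (ha : ∀ v, ‖A.mulVec v‖ ≤ a * ‖v‖) (hZ0 : 0 ≤ Z)
    (hZ : ∀ t, ‖rlKernelDiff (1 - α) t‖ ≤ Z) (hδ : ∀ s ∈ Icc (-τ) 0, ‖φ s‖ ≤ δ) (t : ℝ) :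
    ‖forcing α τ A g φ 0 t‖ ≤ (a + 2 * κ + Z) * δ := by
  have hψ := norm_historyExt_le hτ hδ
  have hx : ∀ t, ‖trajectory (historyExt τ φ) 0 t‖ ≤ δ := fun t => by
    simpa using (norm_trajectory_le (historyExt τ φ) 0 t).trans (add_le_add_left (hψ t) _)
  have h1 : ‖A.mulVec (historyExt τ φ (t - τ))‖ ≤ a * δ := (ha _).trans (by gcongr; exact hψ _)
  have h2 := hg (trajectory (historyExt τ φ) 0 t) (trajectory (historyExt τ φ) 0 (t - τ)) 0 0
  rw [hg0, sub_zero, sub_zero, sub_zero] at h2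
  have h2' := h2.trans (mul_le_mul_of_nonneg_left (add_le_add (hx t) (hx (t - τ))) hκ)
  have h3 : ‖rlKernelDiff (1 - α) t • φ 0‖ ≤ Z * δ := by
    rw [norm_smul]
    have := hδ 0 ⟨by linarith, le_rfl⟩
    have := hZ t
    gcongr
  calc ‖forcing α τ A g φ 0 t‖ ≤ a * δ + κ * (δ + δ) + Z * δ :=
        norm_add₃_le.trans (add_le_add (add_le_add h1 h2') h3)
    _ = _ := by ring

/-- A component of the forcing, cut off to the positive half-line. -/
noncomputable def forcingCut (α τ : ℝ) (A : Matrix (Fin d) (Fin d) ℝ)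
    (g : (Fin d → ℝ) → (Fin d → ℝ) → (Fin d → ℝ)) (φ : ℝ → Fin d → ℝ)
    (z : Fin d → DecaySpace) (i : Fin d) : ℝ → ℝ :=
  indicator (Ici 0) fun t => forcing α τ A g φ z t i

theorem causalCont_indicator {E : Type*} [NormedAddCommGroup E] {w : ℝ → E} (hw : Continuous w) :
    CausalCont (indicator (Ici 0) w) :=
  ⟨fun t ht => indicator_of_notMem (by simpa using ht) _,
    hw.continuousOn.congr fun _ ht => indicator_of_mem ht _⟩

theorem tendsto_indicator_Ici {E : Type*} [NormedAddCommGroup E] {w : ℝ → E}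
    (hw : Tendsto w atTop (𝓝 0)) : Tendsto (indicator (Ici (0 : ℝ)) w) atTop (𝓝 0) := by
  refine hw.congr' ?_
  filter_upwards [eventually_ge_atTop 0] with t ht
  exact (indicator_of_mem (mem_Ici.2 ht) w).symm

theorem CausalCont.ofReal {w : ℝ → ℝ} (hw : CausalCont w) : CausalCont fun t => (w t : ℂ) :=
  ⟨fun t ht => by simp [hw.zero t ht], Complex.continuous_ofReal.comp_continuousOn hw.cont⟩

theorem tendsto_ofReal_zero {w : ℝ → ℝ} (hw : Tendsto w atTop (𝓝 0)) :
    Tendsto (fun t => (w t : ℂ)) atTop (𝓝 0) := by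
  have h := (Complex.continuous_ofReal.tendsto 0).comp hw
  rw [Complex.ofReal_zero] at h
  exact h

/-- If the decaying part solves the integrated equation, the trajectory solves the Caputo
problem. -/
theorem isSolutionOn_trajectory (hα0 : 0 < α) (hα1 : α < 1) (hτ : 0 < τ)
    (hg : Continuous fun z : (Fin d → ℝ) × (Fin d → ℝ) => g z.1 z.2)
    (hφ : ContinuousOn φ (Icc (-τ) 0)) (z : Fin d → DecaySpace)
    (hz : ∀ i t, conv (rlKernel (1 - α)) (fun t => (z i t).re) t =
      conv heaviside (fun t => ∑ j, A i j * (z j (t - τ)).re + forcingCut α τ A g φ z i t) t)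
    (T : ℝ) : IsSolutionOn α τ A g φ T (trajectory (historyExt τ φ) z) := by
  have hx := continuous_trajectory (continuous_historyExt hτ hφ) z
  have hk := causalInt_rlKernel (show 0 < 1 - α by linarith)
  have hH := causalInt_heaviside
  have hz0 : ∀ j t, t ≤ 0 → z j t = 0 := fun j t ht => (z j).2.1 t ht
  refine ⟨hx.continuousOn, ?_, fun t ht => ?_⟩
  swap
  · funext i
    simp [trajectory, hz0 i t ht.2, historyExt_of_mem ht]
  intro t ht i
  set x := trajectory (historyExt τ φ) z with hxdef
  set rhs : ℝ → ℝ := fun t => (A.mulVec (x (t - τ)) + g (x t) (x (t - τ))) i with hrhs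
  have hrc : Continuous rhs := by
    have hs : Continuous fun t : ℝ => t - τ := by fun_prop
    exact (continuous_apply i).comp ((Continuous.matrix_mulVec continuous_const (hx.comp hs)).add
      (hg.comp (hx.prodMk (hx.comp hs))))
  have hD1 := causalCont_rlKernelDiff one_pos
  have hDα := causalCont_rlKernelDiff (show 0 < 1 - α by linarith)
  have hint : ∀ s ∈ Icc 0 T, rlIntegral (1 - α) (fun s => x s i - x 0 i) s =
      ∫ u in (0 : ℝ)..s, rhs u := by
    intro s hs
    -- Subtracting x(0) = φ(0) removes the constant part of the history and leaves z minus a ramp,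
    -- whose fractional integral is explicit. The ramp term in the forcing is there to cancel it.
    have hagree : ∀ u ∈ Icc 0 s, x u i - x 0 i =
        (fun u => (z i u).re - φ 0 i * rlKernelDiff 1 u) u := by
      intro u hu
      simp only [hxdef, trajectory, historyExt_of_nonneg hτ hu.1, historyExt_of_nonneg hτ le_rfl,
        hz0 i 0 le_rfl, rlKernelDiff_of_nonpos le_rfl, Pi.smul_apply, smul_eq_mul, Complex.zero_re]
      ring
    have hzi := (z i).causalCont_re
    have hr := hD1.const_mul (φ 0 i)
    have hrα := hDα.const_mul (φ 0 i)
    rw [rlIntegral_eq_conv (by linarith) (hzi.sub hr).zero hs.1 hagree,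
      conv_sub_right hk hzi hr, hz]
    have h1 : conv (rlKernel (1 - α)) (fun u => φ 0 i * rlKernelDiff 1 u) s =
        conv heaviside (fun u => φ 0 i * rlKernelDiff (1 - α) u) s := by
      have e1 := conv_smul_right (rlKernel (1 - α)) (φ 0 i) (rlKernelDiff 1) s
      have e2 := conv_smul_right heaviside (φ 0 i) (rlKernelDiff (1 - α)) s
      simp only [smul_eq_mul] at e1 e2
      rw [e1, e2, conv_rlKernel_rlKernelDiff (by linarith)]
    have hsum : CausalCont fun t => ∑ j, A i j * (z j (t - τ)).re + forcingCut α τ A g φ z i t :=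
      (CausalCont.sum _ fun j _ => ((z j).causalCont_re_shift hτ.le).const_mul (A i j)).add
        (causalCont_indicator ((continuous_apply i).comp (continuous_forcing hα1 hτ hg hφ z)))
    rw [h1, ← conv_sub_right hH hsum hrα, conv_indicator_one (hsum.sub hrα).zero hs.1]
    refine intervalIntegral.integral_congr fun u hu => ?_
    rw [uIcc_of_le hs.1] at hu
    have hmul : (A.mulVec (x (u - τ))) i =
        (A.mulVec (historyExt τ φ (u - τ))) i + ∑ j, A i j * (z j (u - τ)).re := by
      simp only [Matrix.mulVec, dotProduct, hxdef, trajectory, mul_add, Finset.sum_add_distrib]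
    simp only [hrhs, forcingCut, indicator_of_mem (show u ∈ Ici (0 : ℝ) from hu.1), forcing,
      Pi.add_apply, Pi.smul_apply, smul_eq_mul, hmul, ← hxdef]
    ring
  have hder : HasDerivAt (fun s => ∫ u in (0 : ℝ)..s, rhs u) (rhs t) t :=
    intervalIntegral.integral_hasDerivAt_right (hrc.intervalIntegrable _ _)
      (hrc.stronglyMeasurableAtFilter _ _) hrc.continuousAt
  exact hder.hasDerivWithinAt.congr hint (hint t ⟨ht.1.le, ht.2⟩)

/-- This removes the truncation of g once the solution is known to stay in the cube. -/
theorem IsSolutionOn.congr_nonlinearity {g g' : (Fin d → ℝ) → (Fin d → ℝ) → (Fin d → ℝ)}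
    {T : ℝ} {x : ℝ → Fin d → ℝ} (hx : IsSolutionOn α τ A g φ T x)
    (h : ∀ t, g (x t) (x (t - τ)) = g' (x t) (x (t - τ))) : IsSolutionOn α τ A g' φ T x :=
  ⟨hx.continuousOn, fun t ht i => by rw [← h]; exact hx.equation t ht i, hx.initial⟩

/-- Existence of small decaying solutions for small initial functions. -/
theorem exists_decaying_solution (hα0 : 0 < α) (hα1 : α < 1) (hτ : 0 < τ)
    (A : Matrix (Fin d) (Fin d) ℝ)
    (hA : spectrum ℂ (A.map (fun a : ℝ => (a : ℂ))) ⊆ stabilityRegion α τ) :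
    ∃ κ C : ℝ, 0 < κ ∧ 0 < C ∧ ∀ (g : (Fin d → ℝ) → (Fin d → ℝ) → (Fin d → ℝ)) (ρ : ℝ), 0 < ρ →
      g 0 0 = 0 → LipOnCube g κ ρ → ∀ (φ : ℝ → Fin d → ℝ) (δ : ℝ),
      ContinuousOn φ (Icc (-τ) 0) → (∀ s ∈ Icc (-τ) 0, ‖φ s‖ ≤ δ) → C * δ ≤ ρ →
      ∃ x : ℝ → Fin d → ℝ, Continuous x ∧ (∀ T, IsSolutionOn α τ A g φ T x) ∧
        (∀ t, ‖x t‖ ≤ C * δ) ∧ Tendsto x atTop (𝓝 0) := by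
  obtain ⟨K, G, hK0, hK, hG⟩ := exists_linear_solver hα0 hα1 hτ A hA
  obtain ⟨Z, hZ0, hZ⟩ := (causalCont_rlKernelDiff (show 0 < 1 - α by linarith)).exists_bound
    (tendsto_rlKernelDiff (show 0 < 1 - α by linarith) (by linarith))
  obtain ⟨a, ha0, ha⟩ : ∃ a, 0 ≤ a ∧ ∀ v, ‖A.mulVec v‖ ≤ a * ‖v‖ :=
    ⟨‖(LinearMap.toContinuousLinearMap A.mulVecLin)‖, norm_nonneg _,
      fun v => (LinearMap.toContinuousLinearMap A.mulVecLin).le_opNorm v⟩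
  have hq := integrableKernel_temperedKernel hα0
  set q : ℝ := ∫ u, ‖temperedKernel α u‖ with hqdef
  have hq0 : 0 ≤ q := integral_nonneg fun _ => norm_nonneg _
  -- Chosen so that K q · 2κ ≤ 1/2. The factor 2κ is the Lipschitz constant of the forcing in z,
  -- through the present and the delayed value; the + 1 avoids division by zero.
  set κ : ℝ := 1 / (4 * (K * q + 1)) with hκdef
  have hκ : 0 < κ := by positivity
  have hκ2 : K * q * (2 * κ) ≤ 1 / 2 := by
    rw [hκdef, show K * q * (2 * (1 / (4 * (K * q + 1)))) = K * q / (K * q + 1) / 2 by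
      field_simp; ring]
    have : K * q / (K * q + 1) ≤ 1 := (div_le_one (by positivity)).2 (by linarith)
    linarith
  -- The 1 bounds the history part. The rest bounds the fixed point by ‖z‖ ≤ ½‖z‖ + ‖G(b 0)‖, where
  -- a, 2κ and Z come from A, g and the ramp in the forcing at z = 0.
  refine ⟨κ, 1 + 2 * (K * q * (a + 2 * κ + Z)), hκ, by positivity, ?_⟩
  intro g ρ hρ hg0 hgL φ δ hφ hδ hCδ
  have hδ0 : 0 ≤ δ := (norm_nonneg _).trans (hδ 0 ⟨by linarith, le_rfl⟩)
  set gc : (Fin d → ℝ) → (Fin d → ℝ) → (Fin d → ℝ) := fun x y => g (clamp ρ x) (clamp ρ y)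
    with hgc
  have hgcL : ∀ x y x' y', ‖gc x y - gc x' y'‖ ≤ κ * (‖x - x'‖ + ‖y - y'‖) :=
    hgL.clamp hκ.le hρ.le
  have hgc0 : gc 0 0 = 0 := by
    simp only [hgc]
    rw [clamp_of_norm_le (by simpa using hρ.le), hg0]
  have hgcc := continuous_of_lipschitz_pair hκ.le hgcL
  have hfc : ∀ z i, CausalCont (forcingCut α τ A gc φ z i) := fun z i =>
    causalCont_indicator ((continuous_apply i).comp (continuous_forcing hα1 hτ hgcc hφ z))
  have hfl : ∀ z i, Tendsto (forcingCut α τ A gc φ z i) atTop (𝓝 0) := fun z i =>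
    tendsto_indicator_Ici (tendsto_pi_nhds.1 (tendsto_forcing hα0 hα1 hgcc hgc0 z) i)
  set b : (Fin d → DecaySpace) → Fin d → DecaySpace := fun z i =>
    smoothing hq (hfc z i).ofReal (tendsto_ofReal_zero (hfl z i)) with hb
  have hbsub : ∀ z z', ‖b z - b z'‖ ≤ q * (2 * κ * ‖z - z'‖) := by
    intro z z'
    refine (pi_norm_le_iff_of_nonneg (by positivity)).2 fun i => ?_
    refine norm_smoothing_sub_le hq _ _ _ _ (by positivity) fun t => ?_
    rw [← Complex.ofReal_sub, Complex.norm_real]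
    rcases lt_or_ge t 0 with ht | ht
    · rw [(hfc z i).zero t ht, (hfc z' i).zero t ht, sub_zero, norm_zero]; positivity
    · simp only [forcingCut, indicator_of_mem (mem_Ici.2 ht)]
      exact (norm_le_pi_norm (forcing α τ A gc φ z t - forcing α τ A gc φ z' t) i).trans
        (norm_forcing_sub_le hκ.le hgcL z z' t)
  have hb0 : ‖b 0‖ ≤ q * ((a + 2 * κ + Z) * δ) := by
    refine (pi_norm_le_iff_of_nonneg (by positivity)).2 fun i => ?_
    refine norm_smoothing_le hq _ _ (by positivity) fun t => ?_
    rw [Complex.norm_real]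
    rcases lt_or_ge t 0 with ht | ht
    · rw [(hfc 0 i).zero t ht, norm_zero]; positivity
    · simp only [forcingCut, indicator_of_mem (mem_Ici.2 ht)]
      exact (norm_le_pi_norm (forcing α τ A gc φ 0 t) i).trans
        (norm_forcing_zero_le hτ hκ.le hgcL hgc0 ha0 ha hZ0 hZ hδ t)
  have hcontr : ∀ z z', ‖G (b z) - G (b z')‖ ≤ 1 / 2 * ‖z - z'‖ := by
    intro z z'
    rw [← map_sub]
    calc ‖G (b z - b z')‖ ≤ K * (q * (2 * κ * ‖z - z'‖)) :=
          (hK _).trans (mul_le_mul_of_nonneg_left (hbsub z z') hK0)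
      _ = K * q * (2 * κ) * ‖z - z'‖ := by ring
      _ ≤ _ := mul_le_mul_of_nonneg_right hκ2 (norm_nonneg _)
  have hCW : ContractingWith (1 / 2) fun z => G (b z) := by
    refine ⟨by simpa using NNReal.half_lt_self one_ne_zero, LipschitzWith.of_dist_le_mul fun z z' => ?_⟩
    rw [dist_eq_norm, dist_eq_norm]
    simpa using hcontr z z'
  obtain ⟨z, hz⟩ : ∃ z, G (b z) = z := ⟨_, hCW.fixedPoint_isFixedPt⟩
  have hznorm : ‖z‖ ≤ 2 * (K * q * (a + 2 * κ + Z)) * δ := by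
    have h1 := hcontr z 0
    rw [sub_zero, hz] at h1
    have h2 : ‖G (b 0)‖ ≤ K * (q * ((a + 2 * κ + Z) * δ)) :=
      (hK _).trans (mul_le_mul_of_nonneg_left hb0 hK0)
    have h3 : ‖z‖ ≤ ‖z - G (b 0)‖ + ‖G (b 0)‖ := by
      simpa using norm_add_le (z - G (b 0)) (G (b 0))
    linarith
  have hxnorm : ∀ t, ‖trajectory (historyExt τ φ) z t‖ ≤
      (1 + 2 * (K * q * (a + 2 * κ + Z))) * δ := by
    intro t
    refine (norm_trajectory_le _ _ _).trans ?_
    linarith [norm_historyExt_le hτ hδ t]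
  refine ⟨trajectory (historyExt τ φ) z, continuous_trajectory (continuous_historyExt hτ hφ) z,
    fun T => ?_, hxnorm, tendsto_trajectory (tendsto_historyExt τ φ) z⟩
  have hsol : IsSolutionOn α τ A gc φ T (trajectory (historyExt τ φ) z) := by
    refine isSolutionOn_trajectory hα0 hα1 hτ hgcc hφ z (fun i t => ?_) T
    have h1 := hG (forcingCut α τ A gc φ z) (b z) (hfc z) (fun i t => ?_) i t
    · rwa [hz] at h1
    · change (conv (temperedKernel α) (fun t => (forcingCut α τ A gc φ z i t : ℂ)) t).re = _
      rw [re_conv hq.causalInt (hfc z i).ofReal]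
      rfl
  -- The bound C δ ≤ ρ keeps the trajectory in the cube at all times, so the truncation is inactive.
  refine hsol.congr_nonlinearity fun t => ?_
  simp only [hgc]
  rw [clamp_of_norm_le ((hxnorm _).trans hCδ), clamp_of_norm_le ((hxnorm _).trans hCδ)]

end Existence

/-! ### Uniqueness. -/

section Uniqueness

theorem abs_conv_le_mul_conv_heaviside {a w : ℝ → ℝ} (ha : CausalInt a) (ha0 : ∀ t, 0 ≤ a t)
    (hw : CausalCont w) {c t : ℝ} (hc : ∀ s ≤ t, |w s| ≤ c) :
    |conv a w t| ≤ c * conv a heaviside t := by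
  have h := norm_integral_le_of_norm_le (f := fun u => a u • w (t - u))
    (g := fun u => c * (a u • heaviside (t - u)))
    ((integrable_conv ha causalCont_one t).const_mul c) (Eventually.of_forall fun u => ?_)
  · rwa [integral_const_mul] at h
  · rw [norm_smul, Real.norm_of_nonneg (ha0 u), smul_eq_mul, Real.norm_eq_abs]
    rcases lt_or_ge u 0 with hu | hu
    · simp [ha.zero u hu]
    · rcases lt_or_ge (t - u) 0 with h | h
      · rw [hw.zero _ h, show heaviside (t - u) = 0 from causalInt_heaviside.zero _ h]
        simp
      · rw [heaviside, indicator_of_mem (mem_Ici.2 h), Pi.one_apply, mul_one, mul_comm]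
        exact mul_le_mul_of_nonneg_right (hc _ (by linarith)) (ha0 u)

/-- Inversion of the fractional integral of order `1 - α`. -/
theorem eq_conv_rlKernel_of_conv_eq {α : ℝ} (hα0 : 0 < α) (hα1 : α < 1) {U F : ℝ → ℝ}
    (hU : Continuous U) (hU0 : ∀ t < 0, U t = 0) (hF : CausalCont F) {T : ℝ}
    (h : ∀ s ≤ T, conv (rlKernel (1 - α)) U s = conv heaviside F s) {t : ℝ} (ht : t ∈ Ioo 0 T) :
    U t = conv (rlKernel α) F t := by
  have hk := causalInt_rlKernel hα0
  have hk' := causalInt_rlKernel (show 0 < 1 - α by linarith)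
  have hH := causalInt_heaviside
  have hUc : CausalCont U := .of_continuous hU hU0
  have hV := continuous_conv hk hF
  have hVc : CausalCont (conv (rlKernel α) F) := CausalCont.conv hk hF
  -- Applying I^α to the hypothesis gives I U = I(I^α F), by k_α * k_{1-α} = 1 on the half-line.
  -- Differentiation then removes the outer integral.
  have hint : ∀ s ∈ Ioo 0 T, ∫ u in (0 : ℝ)..s, U u = ∫ u in (0 : ℝ)..s, conv (rlKernel α) F u := by
    intro s hs
    rw [← conv_indicator_one hU0 hs.1.le, ← conv_indicator_one hVc.zero hs.1.le,
      conv_left_comm hH hk hF]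
    change conv heaviside U s = _
    rw [conv_congr_ae heaviside_ae_eq_rlKernel_one, show (1 : ℝ) = α + (1 - α) by ring,
      ← conv_rlKernel hα0 (by linarith), conv_assoc hk hk' hUc]
    exact conv_congr_of_le hs.2.le hk.zero hk.zero (CausalCont.conv hk' hUc).zero
      (CausalCont.conv hH hF).zero (fun _ _ => rfl) fun r hr => h r hr
  have h1 : HasDerivAt (fun s => ∫ u in (0 : ℝ)..s, U u) (U t) t :=
    intervalIntegral.integral_hasDerivAt_right (hU.intervalIntegrable _ _)
      (hU.stronglyMeasurableAtFilter _ _) hU.continuousAt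
  have h2 : HasDerivAt (fun s => ∫ u in (0 : ℝ)..s, conv (rlKernel α) F u)
      (conv (rlKernel α) F t) t :=
    intervalIntegral.integral_hasDerivAt_right (hV.intervalIntegrable _ _)
      (hV.stronglyMeasurableAtFilter _ _) hV.continuousAt
  refine h1.unique (h2.congr_of_eventuallyEq ?_)
  filter_upwards [Ioo_mem_nhds ht.1 ht.2] with s hs using hint s hs

/-- A function with Caputo derivative `v` solves the integrated equation. -/
theorem hasDerivAt_conv_of_hasCaputoDerivWithin {α T : ℝ} (hα0 : 0 < α) {x X : ℝ → ℝ}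
    {T' : ℝ} (hT : T' ≤ T) (hX0 : ∀ t < 0, X t = 0) (hxX : ∀ t ∈ Icc 0 T', x t - x 0 = X t)
    {t v : ℝ} (ht : t ∈ Ioo 0 T') (h : HasCaputoDerivWithin α T x v t) :
    HasDerivAt (conv (rlKernel (1 - α)) X) v t := by
  refine (HasDerivWithinAt.hasDerivAt h (Icc_mem_nhds ht.1 (ht.2.trans_le hT))).congr_of_eventuallyEq
    ?_
  filter_upwards [Ioo_mem_nhds ht.1 ht.2] with s hs
  exact (rlIntegral_eq_conv (by linarith) hX0 hs.1.le
    fun r hr => hxX r ⟨hr.1, hr.2.trans hs.2.le⟩).symm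

variable {d : ℕ} {α τ : ℝ} {A : Matrix (Fin d) (Fin d) ℝ}
  {g : (Fin d → ℝ) → (Fin d → ℝ) → (Fin d → ℝ)} {φ : ℝ → Fin d → ℝ}

/-- Beyond t₀ the difference U solves U = I^α F with ‖F‖ ≤ L‖U‖, and U vanishes up to t₀. On a short
interval L times the kernel mass is below 1/2, so U = 0. Only x is assumed to stay in the cube;
continuity keeps y there for a short time. -/
theorem exists_eqOn_extension (hα0 : 0 < α) (hα1 : α < 1) (hτ : 0 < τ) {L ρ T : ℝ} (hL : 0 ≤ L)
    (hρ : 0 < ρ) (hg : LipOnCube g L ρ) {x y : ℝ → Fin d → ℝ} (hx : IsSolutionOn α τ A g φ T x)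
    (hy : IsSolutionOn α τ A g φ T y) (hxρ : ∀ t ∈ Icc (-τ) T, ‖x t‖ < ρ) {t₀ : ℝ}
    (ht₀ : t₀ ∈ Ico 0 T) (heq : EqOn y x (Icc (-τ) t₀)) :
    ∃ t₂, t₀ < t₂ ∧ t₂ ≤ T ∧ EqOn y x (Icc (-τ) t₂) := by
  have hT0 : 0 < T := ht₀.1.trans_lt ht₀.2
  obtain ⟨η, hη, hyη⟩ : ∃ η > 0, ∀ t ∈ Icc (-τ) T, |t - t₀| < η → ‖y t‖ < ρ := by
    have hmem : t₀ ∈ Icc (-τ) T := ⟨by linarith [ht₀.1], ht₀.2.le⟩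
    have h1 := (hy.continuousOn t₀ hmem).norm
    have h2 : ‖y t₀‖ < ρ := by
      rw [heq ⟨by linarith [ht₀.1], le_rfl⟩]; exact hxρ t₀ hmem
    obtain ⟨η, hη, hη'⟩ := Metric.mem_nhdsWithin_iff.1 (h1.eventually (gt_mem_nhds h2))
    exact ⟨η, hη, fun t ht htη => hη' ⟨by simpa [Real.dist_eq] using htη, ht⟩⟩
  obtain ⟨h₀, hh₀, hker⟩ : ∃ h₀ > 0, ∀ r, |r| < h₀ → rlKernel (1 + α) r < 1 / (2 * (L + 1)) := by
    have h1 := (continuous_rlKernel hα0).tendsto 0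
    rw [rlKernel_of_nonpos le_rfl] at h1
    obtain ⟨h₀, hh₀, h2⟩ := Metric.eventually_nhds_iff.1
      (h1.eventually (gt_mem_nhds (show 0 < 1 / (2 * (L + 1)) by positivity)))
    exact ⟨h₀, hh₀, fun r hr => h2 (by simpa using hr)⟩
  -- Step length: η keeps y in the cube, τ puts the delayed argument at or before t₀ where x and y
  -- agree, and h₀ makes the kernel mass small.
  set m := min (η / 2) (min τ (h₀ / 2)) with hm
  have hm0 : 0 < m := by positivity
  have hmη : m ≤ η / 2 := min_le_left _ _
  have hmτ : m ≤ τ := (min_le_right _ _).trans (min_le_left _ _)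
  have hmh : m ≤ h₀ / 2 := (min_le_right _ _).trans (min_le_right _ _)
  set t₁ := min T (t₀ + m) with ht₁
  have ht₁T : t₁ ≤ T := min_le_left _ _
  have ht₁m : t₁ ≤ t₀ + m := min_le_right _ _
  have ht₀₁ : t₀ < t₁ := lt_min ht₀.2 (by linarith)
  have ht₁0 : 0 < t₁ := ht₀.1.trans_lt ht₀₁
  have hyρ : ∀ t ∈ Icc 0 t₁, ‖y t‖ ≤ ρ := by
    intro t ht
    rcases le_or_gt t t₀ with h | h
    · rw [heq ⟨by linarith [ht.1], h⟩]
      exact (hxρ t ⟨by linarith [ht.1], ht.2.trans ht₁T⟩).le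
    · refine (hyη t ⟨by linarith [ht.1], ht.2.trans ht₁T⟩ ?_).le
      rw [abs_of_pos (by linarith)]
      linarith [ht.2]
  -- Freezing time outside [0, t₁] yields functions continuous on the whole line, while x and y are
  -- controlled only on [-τ, T].
  set c : ℝ → ℝ := fun t => max 0 (min t t₁) with hcdef
  have hcc : Continuous c := by fun_prop
  have hcmem : ∀ t, c t ∈ Icc 0 t₁ := fun t => ⟨le_max_left _ _, max_le ht₁0.le (min_le_right _ _)⟩
  have hcid : ∀ t ∈ Icc 0 t₁, c t = t := fun t ht => by
    simp only [hcdef]; rw [min_eq_left ht.2, max_eq_right ht.1]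
  have hcneg : ∀ t ≤ 0, c t = 0 := fun t ht => by
    simp only [hcdef]; rw [max_eq_left ((min_le_left _ _).trans ht)]
  have hmemT : ∀ t, c t ∈ Icc (-τ) T := fun t =>
    ⟨by linarith [(hcmem t).1], (hcmem t).2.trans ht₁T⟩
  have hdelay : ∀ t, c t - τ ∈ Icc (-τ) t₀ := fun t =>
    ⟨by linarith [(hcmem t).1], by linarith [(hcmem t).2]⟩
  have hxc : Continuous fun t => x (c t) := hx.continuousOn.comp_continuous hcc hmemT
  have hyc : Continuous fun t => y (c t) := hy.continuousOn.comp_continuous hcc hmemT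
  have hxd : Continuous fun t => x (c t - τ) := hx.continuousOn.comp_continuous (by fun_prop)
    fun t => ⟨(hdelay t).1, (hdelay t).2.trans ht₀.2.le⟩
  set U : ℝ → Fin d → ℝ := fun t => x (c t) - y (c t) with hU
  have hUc : Continuous U := hxc.sub hyc
  have hUz : ∀ t ≤ t₀, U t = 0 := by
    intro t ht
    have : c t ≤ t₀ := max_le ht₀.1 ((min_le_left _ _).trans ht)
    simp only [hU]
    rw [heq ⟨(hmemT t).1, this⟩, sub_self]
  set F : ℝ → Fin d → ℝ := fun t => g (clamp ρ (x (c t))) (clamp ρ (x (c t - τ))) -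
    g (clamp ρ (y (c t))) (clamp ρ (x (c t - τ))) with hF
  have hgL := hg.clamp hL hρ.le
  have hgc := continuous_of_lipschitz_pair (g := fun x y => g (clamp ρ x) (clamp ρ y)) hL hgL
  have hFc : Continuous F := (hgc.comp (hxc.prodMk hxd)).sub (hgc.comp (hyc.prodMk hxd))
  have hFU : ∀ t, ‖F t‖ ≤ L * ‖U t‖ := fun t => by
    simpa using hgL (x (c t)) (x (c t - τ)) (y (c t)) (x (c t - τ))
  have hFz : ∀ t ≤ t₀, F t = 0 := fun t ht => by
    have := hFU t
    rw [hUz t ht, norm_zero, mul_zero] at this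
    exact norm_le_zero_iff.1 this
  have hFi : ∀ i, Continuous fun t => F t i := fun i => (continuous_apply i).comp hFc
  have hFi0 : ∀ i, ∀ t < 0, F t i = 0 := fun i t ht => by
    rw [hFz t (ht.le.trans ht₀.1)]; rfl
  have hFcc : ∀ i, CausalCont fun t => F t i := fun i => .of_continuous (hFi i) (hFi0 i)
  have hUi : ∀ i, Continuous fun t => U t i := fun i => (continuous_apply i).comp hUc
  have hUi0 : ∀ i, ∀ t < 0, U t i = 0 := fun i t ht => by
    rw [hUz t (ht.le.trans ht₀.1)]; rfl
  have hk := causalInt_rlKernel (show 0 < 1 - α by linarith)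
  have hconv : ∀ i, ∀ s ≤ t₁, conv (rlKernel (1 - α)) (fun t => U t i) s =
      conv heaviside (fun t => F t i) s := by
    intro i s hs
    rcases lt_or_ge s 0 with hs0 | hs0
    · rw [conv_zero_of_neg hk.zero (hUi0 i) hs0,
        conv_zero_of_neg causalInt_heaviside.zero (hFi0 i) hs0]
    rw [conv_indicator_one (hFi0 i) hs0]
    have hXc : CausalCont fun t => x (c t) i - x 0 i := .of_continuous
      (((continuous_apply i).comp hxc).sub continuous_const) fun t ht => by
        rw [hcneg t ht.le, sub_self]
    have hYc : CausalCont fun t => y (c t) i - y 0 i := .of_continuous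
      (((continuous_apply i).comp hyc).sub continuous_const) fun t ht => by
        rw [hcneg t ht.le, sub_self]
    have hsplit : ∀ s, conv (rlKernel (1 - α)) (fun t => U t i) s =
        conv (rlKernel (1 - α)) (fun t => x (c t) i - x 0 i) s -
          conv (rlKernel (1 - α)) (fun t => y (c t) i - y 0 i) s := by
      intro s
      rw [← conv_sub_right hk hXc hYc]
      congr 1
      funext t
      have h0 : y 0 = x 0 := heq ⟨by linarith, ht₀.1⟩
      simp only [hU, Pi.sub_apply, h0]
      ring
    have hderiv : ∀ t ∈ Ioo 0 t₁,
        HasDerivAt (conv (rlKernel (1 - α)) fun t => U t i) (F t i) t := by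
      intro t ht
      have htI : t ∈ Ioc 0 T := ⟨ht.1, ht.2.le.trans ht₁T⟩
      have htc : c t = t := hcid t ⟨ht.1.le, ht.2.le⟩
      have d1 := hasDerivAt_conv_of_hasCaputoDerivWithin hα0 ht₁T hXc.zero
        (fun r hr => by simp only [hcid r hr]) ht (hx.equation t htI i)
      have d2 := hasDerivAt_conv_of_hasCaputoDerivWithin hα0 ht₁T hYc.zero
        (fun r hr => by simp only [hcid r hr]) ht (hy.equation t htI i)
      have d3 := (d1.sub d2).congr_of_eventuallyEq
        (f₁ := conv (rlKernel (1 - α)) fun t => U t i) (Eventually.of_forall hsplit)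
      refine d3.congr_deriv ?_
      have hd := hdelay t
      rw [htc] at hd
      have hyd : y (t - τ) = x (t - τ) := heq hd
      have hb1 : ‖x t‖ ≤ ρ := (hxρ t ⟨by linarith [ht.1], htI.2⟩).le
      have hb2 : ‖y t‖ ≤ ρ := hyρ t ⟨ht.1.le, ht.2.le⟩
      have hb3 : ‖x (t - τ)‖ ≤ ρ := (hxρ _ ⟨hd.1, hd.2.trans ht₀.2.le⟩).le
      simp only [hF, htc, clamp_of_norm_le hb1, clamp_of_norm_le hb2, clamp_of_norm_le hb3, hyd,
        Pi.add_apply, Pi.sub_apply]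
      ring
    have hcU : Continuous (conv (rlKernel (1 - α)) fun t => U t i) :=
      continuous_conv hk (.of_continuous (hUi i) (hUi0 i))
    rw [intervalIntegral.integral_eq_sub_of_hasDerivAt_of_le hs0 hcU.continuousOn
      (fun t ht => hderiv t ⟨ht.1, ht.2.trans_le hs⟩) ((hFi i).intervalIntegrable _ _),
      conv_nonpos hk (.of_continuous (hUi i) (hUi0 i)) le_rfl, sub_zero]
  -- The inversion formula holds only in the open interval (0, t₁), so the maximum of ‖U‖ is taken
  -- over [t₀, t₂] with t₂ < t₁.
  set t₂ := (t₀ + t₁) / 2 with ht₂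
  have ht₂₁ : t₂ < t₁ := by rw [ht₂]; linarith
  have ht₀₂ : t₀ < t₂ := by rw [ht₂]; linarith
  obtain ⟨tm, htm, hmax⟩ := (isCompact_Icc (a := t₀) (b := t₂)).exists_isMaxOn
    ⟨t₀, le_rfl, ht₀₂.le⟩ hUc.norm.continuousOn
  set S := ‖U tm‖ with hS
  have hSle : ∀ t ≤ t₂, ‖U t‖ ≤ S := by
    intro t ht
    rcases le_or_gt t t₀ with h | h
    · rw [hUz t h, norm_zero]; exact norm_nonneg _
    · exact hmax ⟨h.le, ht⟩
  have hS0 : S = 0 := by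
    rcases htm.1.eq_or_lt with h | h
    · rw [hS, ← h, hUz t₀ le_rfl, norm_zero]
    have hS2 : S ≤ 1 / 2 * S := by
      refine (pi_norm_le_iff_of_nonneg (by positivity)).2 fun i => ?_
      rw [eq_conv_rlKernel_of_conv_eq hα0 hα1 (hUi i) (hUi0 i) (hFcc i) (hconv i)
        ⟨ht₀.1.trans_lt h, htm.2.trans_lt ht₂₁⟩]
      -- Since F vanishes up to t₀, moving the origin there leaves only the kernel mass on [0, tm -
      -- t₀], however large t₀ is.
      set W : ℝ → ℝ := fun t => F (t + t₀) i with hW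
      have hWc : CausalCont W := .of_continuous ((hFi i).comp (by fun_prop)) fun t ht => by
        simp only [hW]
        rw [hFz _ (by linarith)]; rfl
      have hFW : (fun t => F t i) = fun t => W (t - t₀) := by
        funext t; simp [hW]
      rw [hFW, conv_shift, Real.norm_eq_abs]
      refine (abs_conv_le_mul_conv_heaviside (causalInt_rlKernel hα0) (rlKernel_nonneg hα0) hWc
        (c := L * S) fun s hs => ?_).trans ?_
      · refine ((norm_le_pi_norm (F (s + t₀)) i).trans (hFU _)).trans ?_
        exact mul_le_mul_of_nonneg_left (hSle _ (by linarith [htm.2])) hL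
      · rw [conv_rlKernel_heaviside hα0]
        have h1 : rlKernel (1 + α) (tm - t₀) < 1 / (2 * (L + 1)) := hker _ (by
          rw [abs_of_pos (by linarith)]; linarith [htm.2])
        have hLS : 0 ≤ L * S := mul_nonneg hL (norm_nonneg _)
        calc L * S * rlKernel (1 + α) (tm - t₀) ≤ L * S * (1 / (2 * (L + 1))) := by gcongr
          _ = L / (L + 1) * (1 / 2 * S) := by field_simp
          _ ≤ 1 / 2 * S := mul_le_of_le_one_left (by positivity)
            ((div_le_one (by linarith)).2 (by linarith))
    have : 0 ≤ S := norm_nonneg _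
    linarith
  refine ⟨t₂, ht₀₂, ht₂₁.le.trans ht₁T, fun t ht => ?_⟩
  rcases le_or_gt t t₀ with h | h
  · exact heq ⟨ht.1, h⟩
  · have h1 := hSle t ht.2
    rw [hS0] at h1
    have h2 := norm_le_zero_iff.1 h1
    simp only [hU] at h2
    rw [hcid t ⟨by linarith [ht₀.1], ht.2.trans ht₂₁.le⟩] at h2
    exact (sub_eq_zero.1 h2).symm

/-- Uniqueness of solutions which stay in a region where the nonlinearity is Lipschitz. -/
theorem IsSolutionOn.eqOn (hα0 : 0 < α) (hα1 : α < 1) (hτ : 0 < τ) {L ρ T : ℝ} (hL : 0 ≤ L)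
    (hρ : 0 < ρ) (hg : LipOnCube g L ρ) {x y : ℝ → Fin d → ℝ}
    (hx : IsSolutionOn α τ A g φ T x) (hy : IsSolutionOn α τ A g φ T y)
    (hxρ : ∀ t ∈ Icc (-τ) T, ‖x t‖ < ρ) : EqOn y x (Icc (-τ) T) := by
  by_contra hne
  have hinit : EqOn y x (Icc (-τ) 0) := fun t ht => (hy.initial t ht).trans (hx.initial t ht).symm
  obtain ⟨r, hr, hrne⟩ : ∃ r ∈ Icc (-τ) T, y r ≠ x r := by
    by_contra! hall
    exact hne fun r hr => hall r hr
  set B : Set ℝ := {t | t ∈ Icc (-τ) T ∧ y t ≠ x t} with hB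
  have hBne : B.Nonempty := ⟨r, hr, hrne⟩
  have hB0 : ∀ t ∈ B, 0 ≤ t := fun t ht => by
    by_contra h
    exact ht.2 (hinit ⟨ht.1.1, by linarith⟩)
  have hBdd : BddBelow B := ⟨0, hB0⟩
  -- Continuation argument: the solutions agree up to the infimum of the disagreement set, and the
  -- local extension then pushes agreement past it.
  set t₀ := sInf B with ht₀
  have h0 : 0 ≤ t₀ := le_csInf hBne hB0
  have hr₀ : t₀ ≤ r := csInf_le hBdd ⟨hr, hrne⟩
  have hIco : EqOn y x (Ico (-τ) t₀) := fun t ht => by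
    by_contra h
    exact absurd (csInf_le hBdd ⟨⟨ht.1, by linarith [ht.2, hr.2]⟩, h⟩) (not_le.2 ht.2)
  have hsub : Icc (-τ) t₀ ⊆ Icc (-τ) T := Icc_subset_Icc_right (hr₀.trans hr.2)
  have hIcc : EqOn y x (Icc (-τ) t₀) := hIco.of_subset_closure (hy.continuousOn.mono hsub)
    (hx.continuousOn.mono hsub) Ico_subset_Icc_self (by rw [closure_Ico (by linarith)])
  have ht₀T : t₀ < T := by
    refine lt_of_le_of_ne (hr₀.trans hr.2) fun h => hrne (hIcc ⟨hr.1, ?_⟩)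
    rw [h]; exact hr.2
  obtain ⟨t₂, h1, h2, h3⟩ := exists_eqOn_extension hα0 hα1 hτ hL hρ hg hx hy hxρ ⟨h0, ht₀T⟩ hIcc
  obtain ⟨s, hs, hst⟩ := exists_lt_of_csInf_lt hBne h1
  exact hs.2 (h3 ⟨hs.1.1, hst.le⟩)

end Uniqueness

/-! ### Equivalence with the sup norm. -/

section Norms

variable {d : ℕ} (p : Seminorm ℝ (Fin d → ℝ))

theorem exists_seminorm_le_mul_norm : ∃ c : ℝ, 0 < c ∧ ∀ v, p v ≤ c * ‖v‖ := by
  refine ⟨∑ i, p (Pi.single i 1) + 1,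
    by have := Finset.sum_nonneg fun i (_ : i ∈ Finset.univ) => apply_nonneg p (Pi.single i 1);
       linarith, fun v => ?_⟩
  have h1 : p v ≤ ∑ i, p (v i • Pi.single i 1) := by
    conv_lhs => rw [pi_eq_sum_univ' v]
    exact Finset.le_sum_of_subadditive p (map_zero p).le (map_add_le_add p) _ _
  have h2 : ∑ i, p (v i • Pi.single i 1) ≤ (∑ i, p (Pi.single i 1)) * ‖v‖ := by
    rw [Finset.sum_mul]
    refine Finset.sum_le_sum fun i _ => ?_
    rw [map_smul_eq_mul, mul_comm]
    exact mul_le_mul_of_nonneg_left (norm_le_pi_norm v i) (apply_nonneg p _)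
  linarith [norm_nonneg v]

/-- By definiteness, p attains a positive minimum on the compact unit sphere. The sphere is empty
when d = 0, which is treated apart. -/
theorem exists_norm_le_mul_seminorm (hp : ∀ v, p v = 0 → v = 0) :
    ∃ c : ℝ, 0 < c ∧ ∀ v, ‖v‖ ≤ c * p v := by
  obtain ⟨c, hc, hle⟩ := exists_seminorm_le_mul_norm p
  have hcont : Continuous p :=
    (LipschitzWith.of_dist_le_mul (K := ⟨c, hc.le⟩) fun x y => by
      rw [Real.dist_eq, dist_eq_norm]
      exact (abs_sub_map_le_sub p x y).trans (hle _)).continuous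
  rcases (Metric.sphere (0 : Fin d → ℝ) 1).eq_empty_or_nonempty with he | hne
  · refine ⟨1, one_pos, fun v => ?_⟩
    rcases eq_or_ne v 0 with rfl | hv
    · simp
    · have : ‖v‖⁻¹ • v ∈ Metric.sphere (0 : Fin d → ℝ) 1 := by
        simp [norm_smul, inv_mul_cancel₀ (norm_ne_zero_iff.2 hv)]
      rw [he] at this
      exact this.elim
  · obtain ⟨w, hw, hmin⟩ := (isCompact_sphere (0 : Fin d → ℝ) 1).exists_isMinOn hne
      hcont.continuousOn
    have hw0 : w ≠ 0 := by rintro rfl; simp at hw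
    have hpw : 0 < p w := (apply_nonneg p w).lt_of_ne fun h => hw0 (hp w h.symm)
    refine ⟨(p w)⁻¹, inv_pos.2 hpw, fun v => ?_⟩
    rcases eq_or_ne v 0 with rfl | hv
    · simp
    · have hv' := norm_pos_iff.2 hv
      have hm : ‖v‖⁻¹ • v ∈ Metric.sphere (0 : Fin d → ℝ) 1 := by
        simp [norm_smul, inv_mul_cancel₀ hv'.ne']
      have h := isMinOn_iff.1 hmin _ hm
      rw [map_smul_eq_mul, norm_inv, norm_norm, le_inv_mul_iff₀ hv'] at h
      rwa [le_inv_mul_iff₀ hpw, mul_comm]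

variable {p} {g : (Fin d → ℝ) → (Fin d → ℝ) → (Fin d → ℝ)}

theorem seminorm_sub_le_of_lipModulus_lt (hp : ∀ v, p v = 0 → v = 0) {κ ρ : ℝ}
    (h : lipModulus p g ρ < ENNReal.ofReal κ) {x y x' y' : Fin d → ℝ} (hx : p x ≤ ρ)
    (hy : p y ≤ ρ) (hx' : p x' ≤ ρ) (hy' : p y' ≤ ρ) :
    p (g x y - g x' y') ≤ κ * (p (x - x') + p (y - y')) := by
  by_cases he : (x, y) = (x', y')
  · obtain ⟨rfl, rfl⟩ := Prod.mk.inj he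
    simp
  have hle : ENNReal.ofReal (p (g x y - g x' y') / (p (x - x') + p (y - y'))) ≤
      lipModulus p g ρ :=
    le_iSup_of_le x <| le_iSup_of_le y <| le_iSup_of_le x' <| le_iSup_of_le y' <|
      le_iSup_of_le ⟨⟨hx, hy, hx', hy'⟩, he⟩ le_rfl
  have hpos : 0 < p (x - x') + p (y - y') := by
    refine (add_nonneg (apply_nonneg p _) (apply_nonneg p _)).lt_of_ne fun h0 => he ?_
    have h1 := apply_nonneg p (x - x')
    have h2 := apply_nonneg p (y - y')
    rw [sub_eq_zero.1 (hp (x - x') (by linarith)), sub_eq_zero.1 (hp (y - y') (by linarith))]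
  rw [← div_le_iff₀ hpos]
  exact (ENNReal.ofReal_lt_ofReal_iff'.1 (hle.trans_lt h)).1.le

theorem exists_lipOnCube (hp : ∀ v, p v = 0 → v = 0)
    (hg : Tendsto (lipModulus p g) (𝓝[>] 0) (𝓝 0)) {κ : ℝ} (hκ : 0 < κ) :
    ∃ ρ : ℝ, 0 < ρ ∧ LipOnCube g κ ρ := by
  obtain ⟨c₁, hc₁, h₁⟩ := exists_seminorm_le_mul_norm p
  obtain ⟨c₂, hc₂, h₂⟩ := exists_norm_le_mul_seminorm p hp
  -- Passing from p to the sup norm costs a factor c₂ on values and c₁ on arguments.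
  have hκ' : 0 < κ / (c₂ * c₁) := by positivity
  obtain ⟨r, hr, hr0⟩ := ((hg.eventually_lt_const (ENNReal.ofReal_pos.2 hκ')).and
    self_mem_nhdsWithin).exists
  have hball : ∀ v : Fin d → ℝ, ‖v‖ ≤ r / c₁ → p v ≤ r := fun v hv =>
    (h₁ v).trans (by rwa [le_div_iff₀ hc₁, mul_comm] at hv)
  refine ⟨r / c₁, by positivity, fun x y x' y' hx hy hx' hy' => ?_⟩
  have h := seminorm_sub_le_of_lipModulus_lt hp hr (hball x hx) (hball y hy) (hball x' hx')
    (hball y' hy')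
  calc ‖g x y - g x' y'‖ ≤ c₂ * p (g x y - g x' y') := h₂ _
    _ ≤ c₂ * (κ / (c₂ * c₁) * (c₁ * ‖x - x'‖ + c₁ * ‖y - y'‖)) := by
      gcongr
      exact h.trans (by gcongr <;> exact h₁ _)
    _ = κ * (‖x - x'‖ + ‖y - y'‖) := by field_simp

end Norms

/-! ### Conclusion. -/

/-- Small initial functions have a global solution, which is small and tends to `0`. -/
theorem exists_isTheGlobalSolution {d : ℕ} {p : Seminorm ℝ (Fin d → ℝ)}
    (hp : ∀ v : Fin d → ℝ, p v = 0 → v = 0) {α τ : ℝ} (hα0 : 0 < α) (hα1 : α < 1) (hτ : 0 < τ)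
    (A : Matrix (Fin d) (Fin d) ℝ)
    (hA : spectrum ℂ (A.map (fun a : ℝ => (a : ℂ))) ⊆ stabilityRegion α τ)
    {g : (Fin d → ℝ) → (Fin d → ℝ) → (Fin d → ℝ)} (hg0 : g 0 0 = 0)
    (hg : Tendsto (lipModulus p g) (𝓝[>] 0) (𝓝 0)) {ε : ℝ} (hε : 0 < ε) :
    ∃ δ : ℝ, 0 < δ ∧ ∀ φ : ℝ → Fin d → ℝ, ContinuousOn φ (Icc (-τ) 0) →
      (∀ s ∈ Icc (-τ) 0, p (φ s) ≤ δ) → ∃ x : ℝ → Fin d → ℝ,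
        IsTheGlobalSolution α τ A g φ x ∧ (∀ t, p (x t) ≤ ε) ∧ Tendsto x atTop (𝓝 0) := by
  obtain ⟨κ, C, hκ, hC, H⟩ := exists_decaying_solution hα0 hα1 hτ A hA
  obtain ⟨ρ, hρ, hLip⟩ := exists_lipOnCube hp hg hκ
  obtain ⟨c₁, hc₁, h₁⟩ := exists_seminorm_le_mul_norm p
  obtain ⟨c₂, hc₂, h₂⟩ := exists_norm_le_mul_seminorm p hp
  -- The half gives the strict bound ‖x‖ < ρ that uniqueness needs; the other term turns the sup
  -- bound into p ≤ ε.
  set r := min (ρ / 2) (ε / c₁) with hr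
  have hr0 : 0 < r := by positivity
  have hrρ : r < ρ := (min_le_left _ _).trans_lt (by linarith)
  refine ⟨r / (C * c₂), by positivity, fun φ hφ hφδ => ?_⟩
  have hCr : C * (r / C) = r := by field_simp
  obtain ⟨x, hxc, hx, hxb, hx0⟩ := H g ρ hρ hg0 hLip φ (r / C) hφ (fun s hs => by
    calc ‖φ s‖ ≤ c₂ * p (φ s) := h₂ _
      _ ≤ c₂ * (r / (C * c₂)) := by gcongr; exact hφδ s hs
      _ = r / C := by field_simp) (by rw [hCr]; exact hrρ.le)
  rw [hCr] at hxb
  refine ⟨x, ⟨fun T _ => hx T, fun T _ y hy => ?_⟩, fun t => ?_, hx0⟩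
  · exact (hx T).eqOn hα0 hα1 hτ hκ.le hρ hLip hy fun t _ => (hxb t).trans_lt hrρ
  · calc p (x t) ≤ c₁ * ‖x t‖ := h₁ _
      _ ≤ c₁ * (ε / c₁) := by gcongr; exact (hxb t).trans (min_le_right _ _)
      _ = ε := by field_simp

end DelayFDE

theorem mainTheorem1 {d : ℕ} (p : Seminorm ℝ (Fin d → ℝ)) (hp : ∀ v : Fin d → ℝ, p v = 0 → v = 0)
    (α τ : ℝ) (hα0 : 0 < α) (hα1 : α < 1) (hτ : 0 < τ)
    (A : Matrix (Fin d) (Fin d) ℝ)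
    (hA : spectrum ℂ (A.map (fun a : ℝ => (a : ℂ))) ⊆ DelayFDE.stabilityRegion α τ)
    (g : (Fin d → ℝ) → (Fin d → ℝ) → (Fin d → ℝ))
    (hg0 : g 0 0 = 0)
    (hgLip : ∃ U ∈ 𝓝 (0 : (Fin d → ℝ) × (Fin d → ℝ)),
      LocallyLipschitzOn U (fun z : (Fin d → ℝ) × (Fin d → ℝ) => g z.1 z.2))
    (hgMod : Tendsto (DelayFDE.lipModulus p g) (𝓝[>] 0) (𝓝 0)) :
    DelayFDE.IsAsymptoticallyStable p α τ A g := by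
  refine ⟨fun ε hε => ?_, ?_⟩
  · obtain ⟨δ, hδ, h⟩ :=
      DelayFDE.exists_isTheGlobalSolution hp hα0 hα1 hτ A hA hg0 hgMod hε
    refine ⟨δ, hδ, fun φ hφ hφδ => ?_⟩
    obtain ⟨x, hx, hxε, -⟩ := h φ hφ hφδ
    exact ⟨x, hx, fun t _ => hxε t⟩
  · obtain ⟨δ, hδ, h⟩ :=
      DelayFDE.exists_isTheGlobalSolution hp hα0 hα1 hτ A hA hg0 hgMod one_pos
    refine ⟨δ, hδ, fun φ hφ hφδ => ?_⟩
    obtain ⟨x, hx, -, hx0⟩ := h φ hφ hφδ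
    exact ⟨x, hx, hx0⟩
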